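/- Let $\mathfrak g$ be a finite-dimensional complex simple Lie algebra, $\mathfrak t\subset\mathfrak g$ a Cartan subalgebra with root system $R$ and root spaces $\mathfrak g_\alpha$ ($\alpha\in R$), and let $\rho\in R$ be the highest root with respect to a choice of simple roots. Let $0\ne E_\rho\in\mathfrak g_\rho$, let $G$ be the simply connected complex Lie group with Lie algebra $\mathfrak g$, and let $Z_{\mathfrak g}=G\cdot o\subset\mathbb P(\mathfrak g)$, where $o=[E_\rho]$ and $G$ acts through the adjoint representation, be the adjoint variety; here $\mathbb P(\mathfrak g)$ is the space of one-dimensional subspaces of $\mathfrak g$. Identify $T_oZ_{\mathfrak g}$ with $\mathfrak g/\mathfrak p$, where $\mathfrak p$ is the Lie algebra of the stabilizer of $o$ in $G$, through the differential of the orbit map $g\mapsto g\cdot o$, and let $$D_o:=\bigoplus_{\alpha\in R,\ \langle\alpha\,|\,\rho\rangle=-1}\mathfrak g_\alpha\ \subset\ \mathfrak g,\qquad \langle\alpha\,|\,\rho\rangle=\alpha(\rho^\vee),$$ which maps injectively to $\mathfrak g/\mathfrak p\simeq T_oZ_{\mathfrak g}$ (the contact hyperplane at $o$). A line in $\mathbb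 P(\mathfrak g)$ is the projectivization of a two-dimensional subspace of $\mathfrak g$, and a smooth conic is the zero locus, in the projective plane $\mathbb P(U)$ of a three-dimensional subspace $U\subset\mathfrak g$, of a nondegenerate quadratic form on $U$. Then for every nonzero $v\in D_o$ the following are equivalent: 1. there is a line or a smooth conic $C\subset\mathbb P(\mathfrak g)$ such that $C\subset Z_{\mathfrak g}$, $o\in C$ and $T_oC=\mathbb C\cdot v$ in $T_oZ_{\mathfrak g}$; 2. $[v,[v,[v,E_\rho]]]=0$ in $\mathfrak g$. -/

import Mathlib

open scoped LinearAlgebra.Projectivization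

namespace AdjointVariety

noncomputable section

/-! ### Lines, smooth conics and tangent spaces in a projective space -/

section Projective

variable {V : Type*} [AddCommGroup V] [Module ℂ V]

/-- A (linear) line in `ℙ(V)`: the set of points lying in a two-dimensional subspace of `V`. -/
def IsLine (C : Set (ℙ ℂ V)) : Prop :=
  ∃ W : Submodule ℂ V, Module.finrank ℂ W = 2 ∧ C = {p | p.submodule ≤ W}

/-- A smooth conic in `ℙ(V)`: the zero locus, in the plane `ℙ(U)` of a three-dimensional subspace
`U` of `V`, of a nondegenerate quadratic form on `U`. -/
def IsSmoothConic (C : Set (ℙ ℂ V)) : Prop :=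
  ∃ U : Submodule ℂ V, Module.finrank ℂ U = 3 ∧
    ∃ Q : QuadraticForm ℂ U, Q.Nondegenerate ∧
      C = {p | ∃ (x : U) (hx : (x : V) ≠ 0), p = Projectivization.mk ℂ (x : V) hx ∧ Q x = 0}

/-- The value at `x : V` of the polynomial function on `V` given by a polynomial expression in the
linear functionals on `V`. -/
def polyEval (x : V) : MvPolynomial (Module.Dual ℂ V) ℂ →ₐ[ℂ] ℂ :=
  MvPolynomial.aeval fun l : Module.Dual ℂ V => l x

/-- The derivative `D_w f` of a polynomial function `f` on `V` in the constant direction `w`: the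
derivation which sends each linear functional `l` to the constant `l w`. -/
def polyDeriv (w : V) :
    Derivation ℂ (MvPolynomial (Module.Dual ℂ V) ℂ) (MvPolynomial (Module.Dual ℂ V) ℂ) :=
  MvPolynomial.mkDerivation ℂ fun l : Module.Dual ℂ V => MvPolynomial.C (l w)

/-- The polynomial functions on `V` vanishing on the affine cone over `C ⊆ ℙ(V)`. -/
def VanishesOnCone (C : Set (ℙ ℂ V)) (f : MvPolynomial (Module.Dual ℂ V) ℂ) : Prop :=
  ∀ (x : V) (hx : x ≠ 0), Projectivization.mk ℂ x hx ∈ C → polyEval x f = 0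

/-- The Zariski tangent space at `e : V` of the affine cone over `C ⊆ ℙ(V)`: the vectors `w` with
`(D_w f)(e) = 0` for every polynomial function `f` vanishing on the cone. -/
def coneTangentSpace (C : Set (ℙ ℂ V)) (e : V) : Submodule ℂ V where
  carrier := {w | ∀ f, VanishesOnCone C f → polyEval e (polyDeriv w f) = 0}
  zero_mem' := by
    intro f _
    have h : polyDeriv (0 : V) = 0 := by
      apply MvPolynomial.derivation_ext
      intro l
      simp [polyDeriv]
    simp [h]
  add_mem' := by
    intro a b ha hb f hf
    have h : polyDeriv (a + b) = polyDeriv a + polyDeriv b := by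
      apply MvPolynomial.derivation_ext
      intro l
      simp [polyDeriv]
    simp [h, ha f hf, hb f hf]
  smul_mem' := by
    intro c a ha f hf
    have h : polyDeriv (c • a) = c • polyDeriv a := by
      apply MvPolynomial.derivation_ext
      intro l
      simp [polyDeriv, MvPolynomial.smul_eq_C_mul]
    simp [h, ha f hf]

/-- The tangent space of `C ⊆ ℙ(V)` at the point `[e]`, as a subspace of
`T_[e] ℙ(V) = Hom(ℂe, V / ℂe) ≃ V / ℂe` (evaluation at `e`): the image of the tangent space at `e`
of the affine cone over `C`. -/
def projTangentSpace (C : Set (ℙ ℂ V)) (e : V) : Submodule ℂ (V ⧸ (ℂ ∙ e)) :=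
  (coneTangentSpace C e).map (ℂ ∙ e).mkQ

end Projective

/-! ### The adjoint group and the adjoint variety -/

section Lie

variable {𝔤 : Type*} [LieRing 𝔤] [LieAlgebra ℂ 𝔤]

/-- `g = exp(ad x) = ∑ n, (ad x)ⁿ / n!`, the series being tested against linear functionals (for
finite-dimensional `𝔤` this is convergence in the usual topology). -/
def IsExpAd (x : 𝔤) (g : 𝔤 ≃ₗ[ℂ] 𝔤) : Prop :=
  ∀ (y : 𝔤) (l : Module.Dual ℂ 𝔤),
    HasSum (fun n : ℕ => ((n.factorial : ℂ))⁻¹ * l (((LieAlgebra.ad ℂ 𝔤 x) ^ n) y)) (l (g y))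

variable (𝔤) in
/-- The adjoint group of `𝔤`: the group of linear automorphisms of `𝔤` generated by all `exp(ad x)`.
It is the image of the adjoint representation of any connected complex Lie group with Lie
algebra `𝔤`, in particular of the simply connected one. -/
def adjointGroup : Subgroup (𝔤 ≃ₗ[ℂ] 𝔤) :=
  Subgroup.closure {g | ∃ x : 𝔤, IsExpAd x g}

/-- The orbit of `[e] ∈ ℙ(𝔤)` under the adjoint group; for a highest root vector `e` of a simple
Lie algebra this is the adjoint variety. -/
def adjointOrbit (e : 𝔤) : Set (ℙ ℂ 𝔤) :=
  {p | ∃ g ∈ adjointGroup 𝔤, ∃ h : g e ≠ 0, p = Projectivization.mk ℂ (g e) h}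

/-- The differential at the identity of the orbit map `g ↦ g · [e]`, namely
`𝔤 → T_[e] ℙ(𝔤) = 𝔤 / ℂe`, `x ↦ [x, e] mod ℂe`. Its kernel is the Lie algebra `𝔭` of the stabilizer of
`[e]`, and it identifies `𝔤 / 𝔭` with the tangent space at `[e]` of the orbit of `[e]`. -/
def orbitDifferential (e : 𝔤) : 𝔤 →ₗ[ℂ] 𝔤 ⧸ (ℂ ∙ e) where
  toFun x := (ℂ ∙ e).mkQ ⁅x, e⁆
  map_add' x y := by simp only [add_lie, map_add]
  map_smul' c x := by simp only [smul_lie, map_smul, RingHom.id_apply]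

/-- `C ⊆ ℙ(𝔤)` passes through `[e]`, and its tangent line there is (the class in
`T_[e] (G · [e]) ≃ 𝔤 / 𝔭` of) `ℂ v`. -/
def IsTangentAt (C : Set (ℙ ℂ 𝔤)) (e : 𝔤) (he : e ≠ 0) (v : 𝔤) : Prop :=
  Projectivization.mk ℂ e he ∈ C ∧
    projTangentSpace C e = (ℂ ∙ v).map (orbitDifferential e)

variable [FiniteDimensional ℂ 𝔤] [LieAlgebra.IsSimple ℂ 𝔤]
  {H : LieSubalgebra ℂ 𝔤} [H.IsCartanSubalgebra]

/-- `ρ` is the highest root with respect to the base `b` (that is, to the Borel subalgebra given by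
`b`): for every root `β`, the difference `ρ - β` is a sum of simple roots. -/
def IsHighestRoot (b : (LieAlgebra.IsKilling.rootSystem H).Base) (ρ : H.root) : Prop :=
  ∀ β : H.root, (LieAlgebra.IsKilling.rootSystem H).root ρ -
    (LieAlgebra.IsKilling.rootSystem H).root β ∈
      AddSubmonoid.closure ((LieAlgebra.IsKilling.rootSystem H).root '' b.support)

/-- The contact hyperplane `D_o`: the sum of the root spaces `𝔤_α` over the roots `α` whose Cartan
integer `⟨α | ρ⟩ = α(ρ^∨)` is `-1`. -/
def contactHyperplane (ρ : H.root) : Submodule ℂ 𝔤 :=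
  ⨆ (α : H.root) (_ : (LieAlgebra.IsKilling.rootSystem H).pairing α ρ = -1),
    (LieAlgebra.rootSpace H (α : LieModule.Weight ℂ H 𝔤)).toSubmodule

end Lie

end

end AdjointVariety

namespace AdjointVariety

/-! ### Zariski tangent spaces, and quadratic parametrisations of lines and conics. -/

section Projective

variable {V : Type*} [AddCommGroup V] [Module ℂ V]

/-! Write `e` for the highest root vector and `h` for the coroot of `ρ`. As `ρ` is highest, `ad h`
has eigenvalues in `{-2, ..., 2}`, the outer eigenspaces being the lines through `f` and `e`
(`IsHighestRoot.exists_isContactTriple`), and `v` has weight `-1`. Everything rests on equations for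
the cone over the adjoint variety: its nonzero points are exactly the nonzero `x` with `[x,[x,y]] =
Φ(x,y) x` for all `y`, where `Φ` is the Killing form scaled so that `Φ(e,f) = -2`. That such an `x`
lies in the orbit is `mk_mem_adjointOrbit_of_isExtremal`: simplicity allows `x` to be moved off the
hyperplane `Φ(·,f) = 0`, and exponentials of negative weight then carry it to a multiple of `e`.

A line or smooth conic through `[e]` tangent to `v` yields a curve `e + t[v,e] + t²b` in the cone,
with zero also allowed. Comparing powers of `t` in the equations, and weights in each coefficient,
gives `[v,[v,e]] = 2x₀` and `[x₀,v] = 0`, with `x₀` the weight-zero part of `b`; hence the triple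
bracket vanishes (`lie_lie_lie_eq_zero`).

Conversely, if the triple bracket vanishes, `exp(t ad v) e` is quadratic in `t`. It traces a line if
`[v,[v,e]] = 0` and a smooth conic otherwise, since its coefficients have the distinct weights 2, 1,
0. The point at infinity satisfies the equations because its equation is the leading coefficient of
theirs. -/

theorem polyEval_X (x : V) (l : Module.Dual ℂ V) : polyEval x (MvPolynomial.X l) = l x := by
  simp [polyEval]

theorem polyDeriv_X (w : V) (l : Module.Dual ℂ V) :
    polyDeriv w (MvPolynomial.X l) = MvPolynomial.C (l w) := by
  simp [polyDeriv]

theorem polyEval_C (x : V) (a : ℂ) : polyEval x (MvPolynomial.C a) = a := by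
  simp [polyEval]

/-- Every quadratic function on a finite-dimensional space is given by a polynomial expression in
the linear functionals. -/
theorem exists_polynomial_of_bilinear [FiniteDimensional ℂ V] (β : V →ₗ[ℂ] V →ₗ[ℂ] ℂ) :
    ∃ f : MvPolynomial (Module.Dual ℂ V) ℂ, (∀ x, polyEval x f = β x x) ∧
      ∀ e w, polyEval e (polyDeriv w f) = β w e + β e w := by
  let b := Module.finBasis ℂ V
  have key : ∀ x y, β x y = ∑ i, ∑ j, β (b i) (b j) * (b.coord i x * b.coord j y) := by
    intro x y
    conv_lhs => rw [← b.sum_repr x, ← b.sum_repr y]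
    simp only [map_sum, LinearMap.sum_apply, map_smul, LinearMap.smul_apply, smul_eq_mul,
      Finset.mul_sum, Module.Basis.coord_apply]
    rw [Finset.sum_comm]
    refine Finset.sum_congr rfl fun i _ => Finset.sum_congr rfl fun j _ => by ring
  refine ⟨∑ i, ∑ j, MvPolynomial.C (β (b i) (b j)) *
    (MvPolynomial.X (b.coord i) * MvPolynomial.X (b.coord j)), fun x => ?_, fun e w => ?_⟩
  · simp only [map_sum, map_mul, polyEval_X, polyEval_C, key x x]
  · rw [key w e, key e w]
    simp only [← Finset.sum_add_distrib, map_sum]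
    refine Finset.sum_congr rfl fun i _ => Finset.sum_congr rfl fun j _ => ?_
    have hC : polyDeriv w (MvPolynomial.C (β (b i) (b j)) : MvPolynomial (Module.Dual ℂ V) ℂ) = 0 :=
      MvPolynomial.derivation_C _ _
    simp only [Derivation.leibniz, polyDeriv_X, hC, smul_eq_mul, map_add, map_mul, polyEval_X,
      polyEval_C, map_zero]
    ring

/-- A polynomial function vanishing on the curve `t ↦ e + t a + t² b` has vanishing derivative at
`e` in the direction `a`. -/
theorem polyEval_polyDeriv_eq_zero_of_curve (e a b : V) (f : MvPolynomial (Module.Dual ℂ V) ℂ)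
    (hf : ∀ t : ℂ, polyEval (e + t • a + t ^ 2 • b) f = 0) : polyEval e (polyDeriv a f) = 0 := by
  -- `φ` restricts a polynomial function to the curve, as a polynomial in `t`; `h2` is the chain
  -- rule at `t = 0`.
  let φ : MvPolynomial (Module.Dual ℂ V) ℂ →ₐ[ℂ] Polynomial ℂ :=
    MvPolynomial.aeval fun l : Module.Dual ℂ V => Polynomial.C (l e) + Polynomial.X *
      Polynomial.C (l a) + Polynomial.X ^ 2 * Polynomial.C (l b)
  have hφX : ∀ l : Module.Dual ℂ V, φ (MvPolynomial.X l) = Polynomial.C (l e) + Polynomial.X *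
      Polynomial.C (l a) + Polynomial.X ^ 2 * Polynomial.C (l b) := fun l => by simp [φ]
  have h1 : ∀ t p, (φ p).eval t = polyEval (e + t • a + t ^ 2 • b) p := by
    intro t p
    induction p using MvPolynomial.induction_on with
    | C c => simp [φ]
    | add p q hp hq => simp [hp, hq]
    | mul_X p l hp =>
      simp [hp, hφX, polyEval_X]
      left
      ring
  have h2 : ∀ p, (Polynomial.derivative (φ p)).eval 0 = polyEval e (polyDeriv a p) := by
    intro p
    induction p using MvPolynomial.induction_on with
    | C c =>
      have : polyDeriv a (MvPolynomial.C c : MvPolynomial (Module.Dual ℂ V) ℂ) = 0 :=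
        MvPolynomial.derivation_C _ _
      simp [this, φ]
    | add p q hp hq => simp [hp, hq]
    | mul_X p l hp =>
      have := h1 0 p
      simp only [zero_smul, add_zero, ne_eq, OfNat.ofNat_ne_zero, not_false_eq_true,
        zero_pow] at this
      simp only [map_mul, Polynomial.derivative_mul, Polynomial.eval_add, Polynomial.eval_mul, hp,
        hφX, this, Derivation.leibniz, polyDeriv_X, smul_eq_mul, map_add, polyEval_X, polyEval_C]
      simp
      ring
  have h3 : φ f = 0 := Polynomial.funext fun t => by rw [h1, hf]; simp
  rw [← h2, h3]
  simp

/-- The cone tangent space of a set lying in `ℙ(U)` lies in `U`. -/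
theorem coneTangentSpace_le {C : Set (ℙ ℂ V)} {U : Submodule ℂ V}
    (hC : ∀ (x : V) (hx : x ≠ 0), Projectivization.mk ℂ x hx ∈ C → x ∈ U) (e : V) :
    coneTangentSpace C e ≤ U := by
  intro w hw
  by_contra hwU
  obtain ⟨l, hl, hlU⟩ := Submodule.exists_le_ker_of_notMem hwU
  refine hl ?_
  have := hw (MvPolynomial.X l) fun x hx hxC => by
    rw [polyEval_X]; exact hlU (hC x hx hxC)
  rwa [polyDeriv_X, polyEval_C] at this

theorem bilinear_eq_zero_of_mem_coneTangentSpace [FiniteDimensional ℂ V] {C : Set (ℙ ℂ V)}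
    (β : V →ₗ[ℂ] V →ₗ[ℂ] ℂ)
    (hC : ∀ (x : V) (hx : x ≠ 0), Projectivization.mk ℂ x hx ∈ C → β x x = 0) {e w : V}
    (hw : w ∈ coneTangentSpace C e) : β w e + β e w = 0 := by
  obtain ⟨f, hf, hf'⟩ := exists_polynomial_of_bilinear β
  rw [← hf']
  exact hw f fun x hx hxC => by rw [hf, hC x hx hxC]

theorem mem_coneTangentSpace_of_curve {C : Set (ℙ ℂ V)} {e a b : V}
    (hne : ∀ t : ℂ, e + t • a + t ^ 2 • b ≠ 0)
    (h : ∀ t : ℂ, Projectivization.mk ℂ _ (hne t) ∈ C) : a ∈ coneTangentSpace C e :=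
  fun f hf => polyEval_polyDeriv_eq_zero_of_curve e a b f fun t => hf _ (hne t) (h t)

theorem mk_mem_line_iff {W : Submodule ℂ V} {x : V} (hx : x ≠ 0) :
    Projectivization.mk ℂ x hx ∈ {p : ℙ ℂ V | p.submodule ≤ W} ↔ x ∈ W := by
  simp [Projectivization.submodule_mk]

/-- Through a point `[e]` of a line, with tangent direction `a`, there is a parametrisation. -/
theorem IsLine.add_smul_mem {C : Set (ℙ ℂ V)} (hC : IsLine C) {e a : V} (he : e ≠ 0)
    (heC : Projectivization.mk ℂ e he ∈ C)
    (ha : (ℂ ∙ e).mkQ a ∈ projTangentSpace C e) (t : ℂ) (ht : e + t • a ≠ 0) :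
    Projectivization.mk ℂ _ ht ∈ C := by
  obtain ⟨W, -, rfl⟩ := hC
  obtain ⟨w, hw, hwa⟩ := ha
  have hwW := coneTangentSpace_le (fun x hx => (mk_mem_line_iff hx).1) e hw
  rw [mk_mem_line_iff] at heC ⊢
  have h1 : w - a ∈ ℂ ∙ e := by
    rwa [← Submodule.Quotient.eq (p := ℂ ∙ e)]
  obtain ⟨c, hc⟩ := Submodule.mem_span_singleton.1 h1
  have : e + t • a = e + t • (w - c • e) := by rw [hc]; congr 2; abel
  rw [this]
  exact W.add_mem heC (W.smul_mem _ (W.sub_mem hwW (W.smul_mem _ heC)))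

theorem mk_mem_zeroLocus_iff {U : Submodule ℂ V} (Q : QuadraticForm ℂ U) {x : V} (hx : x ≠ 0) :
    Projectivization.mk ℂ x hx ∈ {p : ℙ ℂ V | ∃ (x : U) (hx : (x : V) ≠ 0),
      p = Projectivization.mk ℂ (x : V) hx ∧ Q x = 0} ↔ ∃ y : U, (y : V) = x ∧ Q y = 0 := by
  constructor
  · rintro ⟨y, hy, hxy, hQy⟩
    obtain ⟨c, rfl⟩ := (Projectivization.mk_eq_mk_iff' ℂ _ _ hx hy).1 hxy
    exact ⟨c • y, by simp, by simp [QuadraticMap.map_smul, hQy]⟩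
  · rintro ⟨y, rfl, hQy⟩
    exact ⟨y, hx, rfl, hQy⟩

/-- Through a point `[e]` of a smooth conic, with tangent direction `a`, there is a quadratic
parametrisation (possibly of a tangent line if `a` is degenerate). -/
theorem IsSmoothConic.exists_add_smul_mem [FiniteDimensional ℂ V] {C : Set (ℙ ℂ V)}
    (hC : IsSmoothConic C) {e a : V} (he : e ≠ 0) (heC : Projectivization.mk ℂ e he ∈ C)
    (ha : (ℂ ∙ e).mkQ a ∈ projTangentSpace C e) :
    ∃ b : V, ∀ (t : ℂ) (ht : e + t • a + t ^ 2 • b ≠ 0), Projectivization.mk ℂ _ ht ∈ C := by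
  obtain ⟨U, -, Q, hQ, rfl⟩ := hC
  have hU := fun (x : V) (hx : x ≠ 0) => mk_mem_zeroLocus_iff Q hx
  -- A linear projection onto `U` extends the polar form of `Q` to all of `V`, where tangent vectors
  -- are tested.
  obtain ⟨P, hP⟩ := LinearMap.exists_leftInverse_of_injective U.subtype U.ker_subtype
  have hP' : ∀ y : U, P y = y := fun y => LinearMap.congr_fun hP y
  obtain ⟨w, hw, hwa⟩ := ha
  have hwU := coneTangentSpace_le (U := U) (fun x hx hxC => by
    obtain ⟨y, rfl, -⟩ := (hU x hx).1 hxC; exact y.2) e hw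
  have hβ := bilinear_eq_zero_of_mem_coneTangentSpace
    ((QuadraticMap.polarBilin Q).compl₁₂ P P) (fun x hx hxC => by
    obtain ⟨y, rfl, hy⟩ := (hU x hx).1 hxC
    simp [hP', hy]) hw
  obtain ⟨y, rfl, hQy⟩ := (hU e he).1 heC
  have h1 : w - a ∈ ℂ ∙ (y : V) := by
    rwa [← Submodule.Quotient.eq (p := ℂ ∙ (y : V))]
  obtain ⟨c, hc⟩ := Submodule.mem_span_singleton.1 h1
  obtain ⟨z, rfl⟩ : ∃ z : U, (z : V) = a :=
    ⟨⟨w, hwU⟩ - c • y, by simp [hc]⟩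
  have hwz : (⟨w, hwU⟩ : U) = z + c • y := by
    ext; simp [hc]
  have hPw : P w = z + c • y := by rw [← hwz]; exact hP' ⟨w, hwU⟩
  have hyy : QuadraticMap.polar Q y y = 0 := by simp [hQy]
  have hyz : QuadraticMap.polar Q y z = 0 := by
    rw [LinearMap.compl₁₂_apply, LinearMap.compl₁₂_apply, hP', hPw,
      QuadraticMap.polarBilin_apply_apply, QuadraticMap.polarBilin_apply_apply,
      QuadraticMap.polar_comm Q (z + c • y) y, QuadraticMap.polar_add_right,
      QuadraticMap.polar_smul_right, hyy, smul_zero, add_zero] at hβ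
    linear_combination hβ / 2
  -- The constant and linear terms drop out because `y` is isotropic and `z` is orthogonal to it.
  have hexp : ∀ (t : ℂ) (u : U), Q (y + t • z + t ^ 2 • u) =
      t ^ 2 * (Q z + QuadraticMap.polar Q y u) + t ^ 3 * QuadraticMap.polar Q z u
        + t ^ 4 * Q u := by
    intro t u
    rw [QuadraticMap.map_add Q, QuadraticMap.map_add Q, QuadraticMap.map_smul,
      QuadraticMap.map_smul, QuadraticMap.polar_add_left, QuadraticMap.polar_smul_left,
      QuadraticMap.polar_smul_right, QuadraticMap.polar_smul_right, QuadraticMap.polar_smul_right,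
      hQy, hyz]
    simp only [smul_eq_mul]
    ring
  suffices ∃ u : U, ∀ t : ℂ, Q (y + t • z + t ^ 2 • u) = 0 by
    obtain ⟨u, hu⟩ := this
    exact ⟨u, fun t ht => (hU _ ht).2 ⟨y + t • z + t ^ 2 • u, by simp, hu t⟩⟩
  by_cases hz : Q z = 0
  · refine ⟨0, fun t => ?_⟩
    rw [hexp]
    simp [hz]
  obtain ⟨u, hu⟩ : ∃ u : U, QuadraticMap.polar Q y u ≠ 0 := by
    by_contra! hcon
    have : y ∈ Q.radical := by
      rw [QuadraticMap.mem_radical_iff']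
      exact ⟨hQy, fun n => by simpa [QuadraticMap.polar, hQy, sub_eq_zero] using hcon n⟩
    rw [hQ.radical_eq_bot, Submodule.mem_bot] at this
    exact he (by simp [this])
  have hzz : QuadraticMap.polar Q z z = 2 * Q z := by simp
  have hzy : QuadraticMap.polar Q z y = 0 := by rw [QuadraticMap.polar_comm, hyz]
  let k := QuadraticMap.polar Q y u
  -- Normalised so that `u₁` pairs to 1 with `y` and to 0 with `z`.
  let u₁ : U := k⁻¹ • u - (k⁻¹ * QuadraticMap.polar Q z u / (2 * Q z)) • z
  have hy1 : QuadraticMap.polar Q y u₁ = 1 := by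
    simp [u₁, sub_eq_add_neg, QuadraticMap.polar_add_right, QuadraticMap.polar_neg_right,
      QuadraticMap.polar_smul_right, hyz, k, hu]
  have hz1 : QuadraticMap.polar Q z u₁ = 0 := by
    simp only [u₁, sub_eq_add_neg, QuadraticMap.polar_add_right, QuadraticMap.polar_neg_right,
      QuadraticMap.polar_smul_right, hzz, smul_eq_mul]
    field_simp
    ring
  -- `u₁ - Q u₁ • y` is the isotropic partner of `y`; the factor `-Q z` cancels the coefficient of
  -- `t²`.
  refine ⟨(-Q z) • (u₁ - Q u₁ • y), fun t => ?_⟩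
  have e1 : QuadraticMap.polar Q y ((-Q z) • (u₁ - Q u₁ • y)) = -Q z := by
    simp only [sub_eq_add_neg, QuadraticMap.polar_add_right, QuadraticMap.polar_neg_right,
      QuadraticMap.polar_smul_right, hyy, hy1, smul_eq_mul]
    ring
  have e2 : QuadraticMap.polar Q z ((-Q z) • (u₁ - Q u₁ • y)) = 0 := by
    simp only [sub_eq_add_neg, QuadraticMap.polar_add_right, QuadraticMap.polar_neg_right,
      QuadraticMap.polar_smul_right, hzy, hz1, smul_eq_mul]
    ring
  have e3 : Q ((-Q z) • (u₁ - Q u₁ • y)) = 0 := by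
    have : Q (u₁ - Q u₁ • y) = 0 := by
      rw [sub_eq_add_neg, QuadraticMap.map_add Q, QuadraticMap.map_neg, QuadraticMap.map_smul,
        QuadraticMap.polar_neg_right, QuadraticMap.polar_smul_right, QuadraticMap.polar_comm Q u₁ y,
        hQy, hy1]
      simp
    rw [QuadraticMap.map_smul, this, smul_zero]
  rw [hexp, e1, e2, e3]
  ring

/-- Coordinates on the span, extended to functionals on `V`; the equation of the conic is written in
them. -/
theorem exists_dual_family {n : ℕ} {u : Fin n → V} (hu : LinearIndependent ℂ u) :
    ∃ l : Fin n → Module.Dual ℂ V, ∀ x ∈ Submodule.span ℂ (Set.range u), ∀ c : Fin n → ℂ,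
      x = ∑ i, c i • u i ↔ ∀ i, l i x = c i := by
  obtain ⟨g, hg⟩ := LinearMap.exists_extend (Module.Basis.span hu).equivFun.toLinearMap
  have hgx : ∀ x : Submodule.span ℂ (Set.range u), g x = (Module.Basis.span hu).equivFun x :=
    fun x => LinearMap.congr_fun hg x
  refine ⟨fun i => LinearMap.proj i ∘ₗ g, fun x hx c => ?_⟩
  have h1 : (∀ i, (LinearMap.proj i ∘ₗ g) x = c i) ↔
      (Module.Basis.span hu).equivFun ⟨x, hx⟩ = c := by
    rw [funext_iff, ← hgx]
    rfl
  rw [h1, ← LinearEquiv.eq_symm_apply, Module.Basis.equivFun_symm_apply, Subtype.ext_iff]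
  simp [Module.Basis.span_apply]

end Projective

end AdjointVariety

namespace AdjointVariety

/-! ### Exponentials of `ad x` and the adjoint group. -/

section Exp

variable {𝔤 : Type*} [LieRing 𝔤] [LieAlgebra ℂ 𝔤]

/-- The Leibniz rule for `(ad x)^n` matches the Cauchy product of two exponential series.
Convergence is only known coordinatewise, so the bracket is expanded in a basis and the products are
taken in `ℂ`. -/
theorem lie_map_of_isExpAd [FiniteDimensional ℂ 𝔤] {x : 𝔤} {g : 𝔤 ≃ₗ[ℂ] 𝔤} (hg : IsExpAd x g)
    (y z : 𝔤) : g ⁅y, z⁆ = ⁅g y, g z⁆ := by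
  let b := Module.finBasis ℂ 𝔤
  rw [← sub_eq_zero, ← Module.forall_dual_apply_eq_zero_iff ℂ]
  intro l
  rw [map_sub, sub_eq_zero]
  refine (hg ⁅y, z⁆ l).unique ?_
  let u : 𝔤 → Fin (Module.finrank ℂ 𝔤) → ℕ → ℂ := fun w i n =>
    ((n.factorial : ℂ))⁻¹ * b.coord i (((LieAlgebra.ad ℂ 𝔤 x) ^ n) w)
  have hu : ∀ w i, HasSum (u w i) (b.coord i (g w)) := fun w i => hg w (b.coord i)
  have key : ∀ p q : 𝔤, l ⁅p, q⁆ =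
      ∑ i, ∑ j, l ⁅b i, b j⁆ * (b.coord i p * b.coord j q) := by
    intro p q
    conv_lhs => rw [← b.sum_repr p, ← b.sum_repr q]
    simp only [lie_sum, sum_lie, lie_smul, smul_lie, map_sum, map_smul,
      smul_eq_mul, Module.Basis.coord_apply, Finset.mul_sum]
    rw [Finset.sum_comm]
    refine Finset.sum_congr rfl fun i _ => Finset.sum_congr rfl fun j _ => by ring
  have hprod : ∀ i j, HasSum (fun n => ∑ kl ∈ Finset.HasAntidiagonal.antidiagonal n, u y i kl.1 * u z j kl.2)
      (b.coord i (g y) * b.coord j (g z)) := by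
    intro i j
    have h1 := (hu y i).summable.norm
    have h2 := (hu z j).summable.norm
    have h3 := (summable_norm_sum_mul_antidiagonal_of_summable_norm h1 h2).of_norm.hasSum
    rwa [← tsum_mul_tsum_eq_tsum_sum_antidiagonal_of_summable_norm h1 h2, (hu y i).tsum_eq,
      (hu z j).tsum_eq] at h3
  have hsum := hasSum_sum (s := Finset.univ) fun i _ => hasSum_sum (s := Finset.univ) fun j _ =>
    (hprod i j).mul_left (l ⁅b i, b j⁆)
  rw [key]
  refine Eq.mp (congrArg (fun F => HasSum F _) (funext fun n => Eq.symm ?_)) hsum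
  rw [LieAlgebra.ad_pow_lie, map_sum, Finset.mul_sum]
  simp only [Finset.mul_sum]
  rw [Finset.sum_congr rfl fun i _ => Finset.sum_comm, Finset.sum_comm]
  refine Finset.sum_congr rfl fun kl hkl => ?_
  rw [map_nsmul, key, nsmul_eq_mul, Finset.mul_sum, Finset.mul_sum]
  refine Finset.sum_congr rfl fun i _ => ?_
  rw [Finset.mul_sum, Finset.mul_sum]
  refine Finset.sum_congr rfl fun j _ => ?_
  have hn : kl.1 + kl.2 = n := Finset.HasAntidiagonal.mem_antidiagonal.1 hkl
  have hfac : ((n.choose kl.1 : ℕ) : ℂ) * (kl.1.factorial * kl.2.factorial) = n.factorial := by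
    rw [← hn, Nat.choose_symm_add, ← Nat.add_choose_mul_factorial_mul_factorial kl.1 kl.2, mul_assoc]
    push_cast
    rfl
  have h1 : (kl.1.factorial : ℂ) ≠ 0 := by exact_mod_cast kl.1.factorial_ne_zero
  have h2 : (kl.2.factorial : ℂ) ≠ 0 := by exact_mod_cast kl.2.factorial_ne_zero
  have h3 : (n.choose kl.1 : ℂ) ≠ 0 := fun h => by
    rw [h, zero_mul] at hfac
    exact n.factorial_ne_zero (by exact_mod_cast hfac.symm)
  simp only [u]
  rw [← hfac]
  field_simp

theorem lie_map_of_mem_adjointGroup [FiniteDimensional ℂ 𝔤] {g : 𝔤 ≃ₗ[ℂ] 𝔤}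
    (hg : g ∈ adjointGroup 𝔤) (y z : 𝔤) : g ⁅y, z⁆ = ⁅g y, g z⁆ := by
  induction hg using Subgroup.closure_induction generalizing y z with
  | mem g hg =>
    obtain ⟨x, hx⟩ := hg
    exact lie_map_of_isExpAd hx y z
  | one => rfl
  | mul g h _ _ hg hh => simp only [LinearEquiv.mul_apply, hg, hh]
  | inv g _ hg =>
    apply g.injective
    rw [hg]
    simp only [← LinearEquiv.mul_apply, mul_inv_cancel, LinearEquiv.coe_one, id_eq]

theorem killingForm_map_of_mem_adjointGroup [FiniteDimensional ℂ 𝔤] {g : 𝔤 ≃ₗ[ℂ] 𝔤}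
    (hg : g ∈ adjointGroup 𝔤) (y z : 𝔤) :
    killingForm ℂ 𝔤 (g y) (g z) = killingForm ℂ 𝔤 y z :=
  LieAlgebra.killingForm_of_equiv_apply
    { g with map_lie' := fun {y z} => lie_map_of_mem_adjointGroup hg y z } y z

/-- The exponential of an ad-nilpotent element, as a finite sum. -/
theorem exists_isExpAd_of_ad_pow_eq_zero {x : 𝔤} {k : ℕ} (hx : LieAlgebra.ad ℂ 𝔤 x ^ k = 0) :
    ∃ g : 𝔤 ≃ₗ[ℂ] 𝔤, IsExpAd x g ∧ ∀ y, g y =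
      ∑ n ∈ Finset.range k, ((n.factorial : ℂ))⁻¹ • ((LieAlgebra.ad ℂ 𝔤 x) ^ n) y := by
  -- `IsNilpotent.exp` has rational coefficients; letting `ℚ` act through `ℂ` makes `hsmul`
  -- definitional.
  let _ : Module ℚ (Module.End ℂ 𝔤) := Module.compHom _ (algebraMap ℚ ℂ)
  have hsmul : ∀ (q : ℚ) (f : Module.End ℂ 𝔤), q • f = (q : ℂ) • f := fun q f => rfl
  have hnil : IsNilpotent (LieAlgebra.ad ℂ 𝔤 x) := ⟨k, hx⟩
  have hform : ∀ y, IsNilpotent.exp (LieAlgebra.ad ℂ 𝔤 x) y =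
      ∑ n ∈ Finset.range k, ((n.factorial : ℂ))⁻¹ • ((LieAlgebra.ad ℂ 𝔤 x) ^ n) y := by
    intro y
    rw [IsNilpotent.exp_eq_sum hx, LinearMap.sum_apply]
    refine Finset.sum_congr rfl fun n _ => ?_
    rw [hsmul, LinearMap.smul_apply]
    push_cast
    rfl
  refine ⟨LinearEquiv.ofLinearMap (IsNilpotent.exp (LieAlgebra.ad ℂ 𝔤 x))
    (IsNilpotent.exp (-LieAlgebra.ad ℂ 𝔤 x)) (IsNilpotent.exp_mul_exp_neg_self hnil)
    (IsNilpotent.exp_neg_mul_exp_self hnil), fun y l => ?_, hform⟩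
  rw [LinearEquiv.coe_ofLinearMap, hform, map_sum]
  simp only [map_smul, smul_eq_mul]
  refine hasSum_sum_of_ne_finset_zero fun n hn => ?_
  rw [pow_eq_zero_of_le (by simpa using hn) hx]
  simp

theorem mem_adjointGroup_of_isExpAd {x : 𝔤} {g : 𝔤 ≃ₗ[ℂ] 𝔤} (hg : IsExpAd x g) :
    g ∈ adjointGroup 𝔤 :=
  Subgroup.subset_closure ⟨x, hg⟩

/-- A nonzero vector in the span of an element of the cone over the orbit of `[e]`. -/
theorem mk_mem_adjointOrbit {e x : 𝔤} {g : 𝔤 ≃ₗ[ℂ] 𝔤} (hg : g ∈ adjointGroup 𝔤) {a : ℂ}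
    (hgx : g x = a • e) (hx : x ≠ 0) : Projectivization.mk ℂ x hx ∈ adjointOrbit e := by
  have hxe : x = a • g⁻¹ e := by
    rw [← map_smul, ← hgx, ← LinearEquiv.mul_apply, inv_mul_cancel]
    rfl
  have h0 : g⁻¹ e ≠ 0 := fun h => hx (by rw [hxe, h, smul_zero])
  refine ⟨g⁻¹, inv_mem hg, h0, ?_⟩
  rw [Projectivization.mk_eq_mk_iff']
  exact ⟨a, hxe.symm⟩

/-- A subspace stable under the adjoint group is stable under all ad-nilpotent elements. -/
theorem lie_mem_of_forall_adjointGroup {N : Submodule ℂ 𝔤}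
    (hN : ∀ g ∈ adjointGroup 𝔤, ∀ x ∈ N, g x ∈ N) {y x : 𝔤}
    (hy : IsNilpotent (LieAlgebra.ad ℂ 𝔤 y)) (hx : x ∈ N) : ⁅y, x⁆ ∈ N := by
  obtain ⟨k, hk⟩ := hy
  by_contra hcon
  obtain ⟨l, hl, hlN⟩ := Submodule.exists_le_ker_of_notMem hcon
  refine hl ?_
  -- This is `t ↦ l (exp(t ad y) x)`, which vanishes identically; its linear coefficient is `l ⁅y,
  -- x⁆`. The range `k + 2` ensures that the index 1 occurs even for small `k`.
  let p : Polynomial ℂ := ∑ n ∈ Finset.range (k + 2), Polynomial.monomial n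
    (((n.factorial : ℂ))⁻¹ * l (((LieAlgebra.ad ℂ 𝔤 y) ^ n) x))
  have hp : p = 0 := Polynomial.funext fun t => by
    have ht : LieAlgebra.ad ℂ 𝔤 (t • y) ^ (k + 2) = 0 := by
      rw [map_smul, smul_pow, pow_add (LieAlgebra.ad ℂ 𝔤 y), hk, zero_mul, smul_zero]
    obtain ⟨g, hg, hgx⟩ := exists_isExpAd_of_ad_pow_eq_zero ht
    have := hlN (hN g (mem_adjointGroup_of_isExpAd hg) x hx)
    rw [LinearMap.mem_ker, hgx, map_sum] at this
    rw [Polynomial.eval_finsetSum, Polynomial.eval_zero, ← this]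
    refine Finset.sum_congr rfl fun n _ => ?_
    rw [map_smul (LieAlgebra.ad ℂ 𝔤), smul_pow, LinearMap.smul_apply, map_smul, map_smul,
      Polynomial.eval_monomial, smul_eq_mul, smul_eq_mul]
    ring
  have h1 := congrArg (fun q => Polynomial.coeff q 1) hp
  simpa [p, Polynomial.finsetSum_coeff, Polynomial.coeff_monomial] using h1

end Exp

/-! ### Orbits under the adjoint group span. -/

section Nonvanishing

variable {𝔤 : Type*} [LieRing 𝔤] [LieAlgebra ℂ 𝔤] [FiniteDimensional ℂ 𝔤] [LieAlgebra.IsSimple ℂ 𝔤]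

/-- A simple complex Lie algebra is spanned, as a Lie algebra, by its ad-nilpotent elements. -/
theorem lieSubalgebra_eq_top_of_nilpotent_mem (H : LieSubalgebra ℂ 𝔤) [H.IsCartanSubalgebra]
    (S : LieSubalgebra ℂ 𝔤) (hS : ∀ y, IsNilpotent (LieAlgebra.ad ℂ 𝔤 y) → y ∈ S) : S = ⊤ := by
  have hroot : ∀ (α : LieModule.Weight ℂ H 𝔤), α.IsNonZero →
      ∀ y ∈ LieAlgebra.rootSpace H α, y ∈ S := fun α hα y hy =>
    hS y (LieAlgebra.isNilpotent_ad_of_mem_rootSpace H (χ := α) hα hy)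
  -- Coroots span the Cartan subalgebra, and each is a bracket of two root vectors.
  have hH : ∀ y : H, (y : 𝔤) ∈ S := by
    intro y
    have hy : y ∈ Submodule.span ℂ (Set.range (LieAlgebra.IsKilling.rootSystem H).coroot) := by
      have := RootPairing.IsRootSystem.span_coroot_eq_top (P := LieAlgebra.IsKilling.rootSystem H)
      rw [this]
      trivial
    induction hy using Submodule.span_induction with
    | mem y hy =>
      obtain ⟨α, rfl⟩ := hy
      have hα : (α : LieModule.Weight ℂ H 𝔤).IsNonZero := (Finset.mem_filter.1 α.2).2
      obtain ⟨h, e, f, ht, he, hf⟩ := LieAlgebra.IsKilling.exists_isSl2Triple_of_weight_isNonZero hα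
      have := ht.h_eq_coroot hα he hf
      rw [LieAlgebra.IsKilling.rootSystem_coroot_apply, ← this, ← ht.lie_e_f]
      refine S.lie_mem (hroot _ hα _ he) (hroot (-α) (by simpa using hα) _ ?_)
      simpa using hf
    | zero => simp
    | add a b _ _ ha hb => simpa using S.add_mem ha hb
    | smul c a _ ha => simpa using S.smul_mem c ha
  rw [← LieSubalgebra.toSubmodule_inj, LieSubalgebra.top_toSubmodule, eq_top_iff]
  have htop := congrArg LieSubmodule.toSubmodule
    (LieModule.iSup_genWeightSpace_eq_top' ℂ H 𝔤)
  rw [LieSubmodule.top_toSubmodule, LieSubmodule.iSup_toSubmodule] at htop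
  rw [← htop, iSup_le_iff]
  intro α y hy
  by_cases hα : α.IsZero
  · have : y ∈ LieAlgebra.rootSpace H (0 : H → ℂ) := by
      rw [← show (α : H → ℂ) = 0 from hα]; exact hy
    rw [LieAlgebra.rootSpace_zero_eq] at this
    exact hH ⟨y, this⟩
  · exact hroot α hα y hy

/-- The orbit of a nonzero vector is not contained in a hyperplane. -/
theorem exists_mem_adjointGroup_apply_ne_zero (H : LieSubalgebra ℂ 𝔤) [H.IsCartanSubalgebra]
    {x : 𝔤} (hx : x ≠ 0) {l : Module.Dual ℂ 𝔤} (hl : l ≠ 0) :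
    ∃ g ∈ adjointGroup 𝔤, l (g x) ≠ 0 := by
  by_contra! hcon
  -- The vectors whose whole orbit lies in `ker l`. Its stabiliser `S` contains all ad-nilpotent
  -- elements, so `N` is an ideal, and simplicity contradicts `x ≠ 0` or `l ≠ 0`.
  let N : Submodule ℂ 𝔤 :=
    { carrier := {x | ∀ g ∈ adjointGroup 𝔤, l (g x) = 0}
      zero_mem' := fun g _ => by simp
      add_mem' := fun ha hb g hg => by simp [ha g hg, hb g hg]
      smul_mem' := fun c a ha g hg => by simp [ha g hg] }
  have hN : ∀ g ∈ adjointGroup 𝔤, ∀ x ∈ N, g x ∈ N := fun g hg x hx h hh => by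
    rw [← LinearEquiv.mul_apply]
    exact hx _ (mul_mem hh hg)
  let S : LieSubalgebra ℂ 𝔤 :=
    { carrier := {y | ∀ x ∈ N, ⁅y, x⁆ ∈ N}
      zero_mem' := fun x _ => by simp
      add_mem' := fun ha hb x hx => by rw [add_lie]; exact N.add_mem (ha x hx) (hb x hx)
      smul_mem' := fun c a ha x hx => by rw [smul_lie]; exact N.smul_mem c (ha x hx)
      lie_mem' := fun ha hb x hx => by
        rw [lie_lie]; exact N.sub_mem (ha _ (hb x hx)) (hb _ (ha x hx)) }
  have hS : S = ⊤ := lieSubalgebra_eq_top_of_nilpotent_mem H S fun y hy x hx =>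
    lie_mem_of_forall_adjointGroup hN hy hx
  let I : LieIdeal ℂ 𝔤 :=
    { N with
      lie_mem := fun {y x} hx => by
        have : y ∈ S := hS ▸ LieSubalgebra.mem_top y
        exact this x hx }
  rcases LieAlgebra.IsSimple.eq_bot_or_eq_top I with hI | hI
  · have : x ∈ I := hcon
    rw [hI] at this
    exact hx (by simpa using this)
  · refine hl (LinearMap.ext fun y => ?_)
    have : y ∈ I := hI ▸ LieSubmodule.mem_top y
    simpa using this 1 (one_mem _)

end Nonvanishing

end AdjointVariety

namespace AdjointVariety

/-! ### The contact grading, and extremality along a quadratic curve. -/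

section Weights

variable {𝔤 : Type*} [LieRing 𝔤] [LieAlgebra ℂ 𝔤]

/-- `x` is an eigenvector of `ad h` with eigenvalue `k` (or zero). -/
def IsWeightVector (h : 𝔤) (k : ℂ) (x : 𝔤) : Prop := ⁅h, x⁆ = k • x

namespace IsWeightVector

variable {h x y : 𝔤} {i j : ℂ}

theorem zero (h : 𝔤) (k : ℂ) : IsWeightVector h k 0 := by simp [IsWeightVector]

theorem self (h : 𝔤) : IsWeightVector h 0 h := by simp [IsWeightVector]

theorem add (hx : IsWeightVector h i x) (hy : IsWeightVector h i y) :
    IsWeightVector h i (x + y) := by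
  simp only [IsWeightVector] at *
  rw [lie_add, hx, hy, smul_add]

theorem smul (c : ℂ) (hx : IsWeightVector h i x) : IsWeightVector h i (c • x) := by
  simp only [IsWeightVector] at *
  rw [lie_smul, hx, smul_comm]

theorem neg (hx : IsWeightVector h i x) : IsWeightVector h i (-x) := by
  simp only [IsWeightVector] at *
  rw [lie_neg, hx, smul_neg]

theorem sub (hx : IsWeightVector h i x) (hy : IsWeightVector h i y) :
    IsWeightVector h i (x - y) := by
  rw [sub_eq_add_neg]
  exact hx.add hy.neg

theorem lie {k : ℂ} (hx : IsWeightVector h i x) (hy : IsWeightVector h j y) (hk : i + j = k) :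
    IsWeightVector h k ⁅x, y⁆ := by
  simp only [IsWeightVector] at *
  rw [leibniz_lie, hx, hy, smul_lie, lie_smul, ← add_smul, hk]

/-- Four applications of `ad h` give a Vandermonde system with nodes 2, 1, 0, -1, -2; the final
combinations are its Lagrange interpolation polynomials. -/
theorem eq_zero_of_sum_eq_zero {a₂ a₁ a₀ b₁ b₂ : 𝔤} (h2 : IsWeightVector h 2 a₂)
    (h1 : IsWeightVector h 1 a₁) (h0 : IsWeightVector h 0 a₀) (h1' : IsWeightVector h (-1) b₁)
    (h2' : IsWeightVector h (-2) b₂) (hsum : a₂ + a₁ + a₀ + b₁ + b₂ = 0) :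
    a₂ = 0 ∧ a₁ = 0 ∧ a₀ = 0 ∧ b₁ = 0 ∧ b₂ = 0 := by
  simp only [IsWeightVector] at *
  have s1 := congrArg (fun z => ⁅h, z⁆) hsum
  simp only [lie_add, h2, h1, h0, h1', h2', lie_zero] at s1
  have s2 := congrArg (fun z => ⁅h, z⁆) s1
  simp only [lie_add, lie_smul, h2, h1, h0, h1', h2', lie_zero] at s2
  have s3 := congrArg (fun z => ⁅h, z⁆) s2
  simp only [lie_add, lie_smul, h2, h1, h0, h1', h2', lie_zero] at s3
  have s4 := congrArg (fun z => ⁅h, z⁆) s3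
  simp only [lie_add, lie_smul, h2, h1, h0, h1', h2', lie_zero] at s4
  refine ⟨?_, ?_, ?_, ?_, ?_⟩
  · linear_combination (norm := module) (1 / 24 : ℂ) • (s4 + (2 : ℂ) • s3 - s2 - (2 : ℂ) • s1)
  · linear_combination (norm := module) (-1 / 6 : ℂ) • (s4 + s3 - (4 : ℂ) • s2 - (4 : ℂ) • s1)
  · linear_combination (norm := module) (1 / 4 : ℂ) • (s4 - (5 : ℂ) • s2 + (4 : ℂ) • hsum)
  · linear_combination (norm := module) (-1 / 6 : ℂ) • (s4 - s3 - (4 : ℂ) • s2 + (4 : ℂ) • s1)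
  · linear_combination (norm := module) (1 / 24 : ℂ) • (s4 - (2 : ℂ) • s3 - s2 + (2 : ℂ) • s1)

/-- An invariant form pairs weight vectors to zero unless their weights are opposite. -/
theorem form_eq_zero {Φ : LinearMap.BilinForm ℂ 𝔤} (hΦ : ∀ x y z, Φ ⁅x, y⁆ z = Φ x ⁅y, z⁆)
    (hx : IsWeightVector h i x) (hy : IsWeightVector h j y) (hij : i + j ≠ 0) : Φ x y = 0 := by
  have h1 := hΦ x h y
  rw [← lie_skew, hx, hy] at h1
  simp only [map_neg, map_smul, LinearMap.neg_apply, LinearMap.smul_apply, smul_eq_mul] at h1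
  have : (i + j) * Φ x y = 0 := by linear_combination -h1
  exact (mul_eq_zero.1 this).resolve_left hij

end IsWeightVector

/-- The grading of `𝔤` by the eigenvalues of `ad h` is `𝔤₋₂ ⊕ 𝔤₋₁ ⊕ 𝔤₀ ⊕ 𝔤₁ ⊕ 𝔤₂`, with the outer
pieces spanned by the members `f` and `e` of an `𝔰𝔩₂`-triple `(e, h, f)`. -/
structure IsContactTriple (e h f : 𝔤) : Prop where
  e_ne_zero : e ≠ 0
  lie_e_f : ⁅e, f⁆ = h
  weight_e : IsWeightVector h 2 e
  weight_f : IsWeightVector h (-2) f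
  exists_decomposition : ∀ x : 𝔤, ∃ (a b : ℂ) (x₁ x₀ y₁ : 𝔤), IsWeightVector h 1 x₁ ∧
    IsWeightVector h 0 x₀ ∧ IsWeightVector h (-1) y₁ ∧ x = a • e + x₁ + x₀ + y₁ + b • f

/-- `x` is extremal (relative to the bilinear form `Φ`): the equations cutting out the cone over
the adjoint variety. -/
def IsExtremal (Φ : LinearMap.BilinForm ℂ 𝔤) (x : 𝔤) : Prop := ∀ y, ⁅x, ⁅x, y⁆⁆ = Φ x y • x

/-- Coefficients of the extremality equation along a quadratic curve. -/
theorem IsExtremal.curve {Φ : LinearMap.BilinForm ℂ 𝔤} {e a b : 𝔤}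
    (h : ∀ t : ℂ, IsExtremal Φ (e + t • a + t ^ 2 • b)) (y : 𝔤) :
    ⁅a, ⁅a, y⁆⁆ + ⁅e, ⁅b, y⁆⁆ + ⁅b, ⁅e, y⁆⁆ = Φ a y • a + Φ b y • e + Φ e y • b ∧
      ⁅a, ⁅b, y⁆⁆ + ⁅b, ⁅a, y⁆⁆ = Φ a y • b + Φ b y • a ∧ ⁅b, ⁅b, y⁆⁆ = Φ b y • b := by
  -- Both sides have degree at most four in `t`, so five values determine the coefficients of `t²`,
  -- `t³` and `t⁴`.
  have h0 := h 0 y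
  have h1 := h 1 y
  have h2 := h (-1) y
  have h3 := h 2 y
  have h4 := h (-2) y
  simp only [add_lie, smul_lie, lie_add, lie_smul, map_add, map_smul, LinearMap.add_apply,
    LinearMap.smul_apply, smul_eq_mul] at h0 h1 h2 h3 h4
  refine ⟨?_, ?_, ?_⟩
  · linear_combination (norm := module) (-5 / 4 : ℂ) • h0 + (2 / 3 : ℂ) • (h1 + h2) -
      (1 / 24 : ℂ) • (h3 + h4)
  · linear_combination (norm := module) (1 / 12 : ℂ) • (h3 - h4) - (1 / 6 : ℂ) • (h1 - h2)
  · linear_combination (norm := module) (1 / 4 : ℂ) • h0 - (1 / 6 : ℂ) • (h1 + h2) +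
      (1 / 24 : ℂ) • (h3 + h4)

namespace IsContactTriple

variable {e h f : 𝔤}

theorem h_ne_zero (T : IsContactTriple e h f) : h ≠ 0 := by
  rintro rfl
  have := T.weight_e
  simp only [IsWeightVector, zero_lie] at this
  exact T.e_ne_zero (by simpa using this.symm)

/-- Applying `ad h - k` scales each of the five components of `x` by a nonzero number and gives
zero. -/
theorem eq_zero_of_weight (T : IsContactTriple e h f) {k : ℂ} {x : 𝔤} (hx : IsWeightVector h k x)
    (h2 : k ≠ 2) (h1 : k ≠ 1) (h0 : k ≠ 0) (h1' : k ≠ -1) (h2' : k ≠ -2) : x = 0 := by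
  obtain ⟨a, b, x₁, x₀, y₁, hx₁, hx₀, hy₁, rfl⟩ := T.exists_decomposition x
  have he := T.weight_e.smul a
  have hf := T.weight_f.smul b
  obtain ⟨e2, e1, e0, e1', e2'⟩ := IsWeightVector.eq_zero_of_sum_eq_zero (he.smul (2 - k))
    (hx₁.smul (1 - k)) (hx₀.smul (0 - k)) (hy₁.smul (-1 - k)) (hf.smul (-2 - k)) (by
      simp only [IsWeightVector, lie_add] at *
      rw [he, hx₁, hx₀, hy₁, hf] at hx
      linear_combination (norm := module) hx)
  rw [(smul_eq_zero.1 e2).resolve_left (sub_ne_zero.2 h2.symm),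
    (smul_eq_zero.1 e1).resolve_left (sub_ne_zero.2 h1.symm),
    (smul_eq_zero.1 e0).resolve_left (sub_ne_zero.2 h0.symm),
    (smul_eq_zero.1 e1').resolve_left (sub_ne_zero.2 h1'.symm),
    (smul_eq_zero.1 e2').resolve_left (sub_ne_zero.2 h2'.symm)]
  simp

theorem exists_eq_smul_e (T : IsContactTriple e h f) {x : 𝔤} (hx : IsWeightVector h 2 x) :
    ∃ c : ℂ, x = c • e := by
  obtain ⟨a, b, x₁, x₀, y₁, hx₁, hx₀, hy₁, hsum⟩ := T.exists_decomposition x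
  obtain ⟨e2, -⟩ := IsWeightVector.eq_zero_of_sum_eq_zero ((T.weight_e.smul a).sub hx)
    hx₁ hx₀ hy₁ (T.weight_f.smul b) (by linear_combination (norm := module) -hsum)
  exact ⟨a, (sub_eq_zero.1 e2).symm⟩

theorem exists_eq_smul_f (T : IsContactTriple e h f) {x : 𝔤} (hx : IsWeightVector h (-2) x) :
    ∃ c : ℂ, x = c • f := by
  obtain ⟨a, b, x₁, x₀, y₁, hx₁, hx₀, hy₁, hsum⟩ := T.exists_decomposition x
  obtain ⟨-, -, -, -, e2⟩ := IsWeightVector.eq_zero_of_sum_eq_zero (T.weight_e.smul a)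
    hx₁ hx₀ hy₁ ((T.weight_f.smul b).sub hx) (by linear_combination (norm := module) -hsum)
  exact ⟨b, (sub_eq_zero.1 e2).symm⟩

theorem lie_e_eq_zero (T : IsContactTriple e h f) {x : 𝔤} (hx : IsWeightVector h 1 x) :
    ⁅x, e⁆ = 0 :=
  T.eq_zero_of_weight (hx.lie T.weight_e rfl) (by norm_num) (by norm_num) (by norm_num)
    (by norm_num) (by norm_num)

theorem lie_f_eq_zero (T : IsContactTriple e h f) {x : 𝔤} (hx : IsWeightVector h (-1) x) :
    ⁅x, f⁆ = 0 :=
  T.eq_zero_of_weight (hx.lie T.weight_f rfl) (by norm_num) (by norm_num) (by norm_num)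
    (by norm_num) (by norm_num)

theorem lie_e_h (T : IsContactTriple e h f) : ⁅e, h⁆ = (-2 : ℂ) • e := by
  rw [← lie_skew, T.weight_e, neg_smul]

theorem lie_lie_f_e (T : IsContactTriple e h f) {x : 𝔤} (hx : IsWeightVector h 1 x) :
    ⁅⁅x, f⁆, e⁆ = x := by
  rw [lie_lie, T.lie_e_eq_zero hx, lie_zero, sub_zero, ← lie_skew f e, T.lie_e_f, lie_neg,
    lie_skew, hx, one_smul]

theorem lie_lie_e_f (T : IsContactTriple e h f) {x : 𝔤} (hx : IsWeightVector h (-1) x) :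
    ⁅⁅x, e⁆, f⁆ = x := by
  rw [lie_lie, T.lie_f_eq_zero hx, lie_zero, sub_zero, T.lie_e_f, ← lie_skew, hx]
  simp

/-- If the cone over the adjoint variety contains the curve `t ↦ e + t [v, e] + t² b` with `v` of
weight `-1`, then `[v, [v, [v, e]]] = 0`. -/
theorem lie_lie_lie_eq_zero (T : IsContactTriple e h f) {Φ : LinearMap.BilinForm ℂ 𝔤}
    (hΦ : ∀ x y z, Φ ⁅x, y⁆ z = Φ x ⁅y, z⁆) (hef : Φ e f = -2) {v b : 𝔤}
    (hv : IsWeightVector h (-1) v) (hx : ∀ t : ℂ, IsExtremal Φ (e + t • ⁅v, e⁆ + t ^ 2 • b)) :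
    ⁅v, ⁅v, ⁅v, e⁆⁆⁆ = 0 := by
  have hA : IsWeightVector h 1 ⁅v, e⁆ := hv.lie T.weight_e (by norm_num)
  have hV2 : IsWeightVector h 0 ⁅v, ⁅v, e⁆⁆ := hv.lie hA (by norm_num)
  have hV3 : IsWeightVector h (-1) ⁅v, ⁅v, ⁅v, e⁆⁆⁆ := hv.lie hV2 (by norm_num)
  have hAf : ⁅⁅v, e⁆, f⁆ = v := T.lie_lie_e_f hv
  have hΦA : Φ ⁅v, e⁆ f = 0 := hA.form_eq_zero hΦ T.weight_f (by norm_num)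
  obtain ⟨α, β, x₁, x₀, y₁, hx₁, hx₀, hy₁, hb⟩ := T.exists_decomposition b
  obtain ⟨m, hm⟩ := T.exists_eq_smul_f (hx₀.lie T.weight_f (by norm_num))
  obtain ⟨n, hn⟩ := T.exists_eq_smul_e (hx₀.lie T.weight_e (by norm_num))
  have hbf : ⁅b, f⁆ = α • h + ⁅x₁, f⁆ + m • f := by
    simp only [hb, add_lie, smul_lie, T.lie_e_f, hm, T.lie_f_eq_zero hy₁, lie_self]
    simp
  have hbh : ⁅b, h⁆ = (-2 * α) • e - x₁ + y₁ + (2 * β) • f := by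
    have he := T.weight_e
    have hf := T.weight_f
    simp only [IsWeightVector] at he hf hx₁ hx₀ hy₁
    rw [← lie_skew]
    simp only [hb, lie_add, lie_smul, he, hf, hx₁, hx₀, hy₁]
    module
  have hexf : ⁅e, ⁅x₁, f⁆⁆ = -x₁ := by rw [← lie_skew, T.lie_lie_f_e hx₁]
  -- In the coefficient of `t²` at `f`, weights -1 and -2 kill the negative part of `b`, and weight
  -- 0 reads `m • h - ⁅v, ⁅v, e⁆⁆ + 2 • x₀ = 0`.
  obtain ⟨c2, -, -⟩ := IsExtremal.curve hx f
  rw [hAf, T.lie_e_f, hbf, hbh, hΦA, hef, lie_add, lie_add, lie_smul, lie_smul, T.lie_e_h, hexf,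
    T.lie_e_f, ← lie_skew] at c2
  have hΦb : Φ b f = -2 * α := by
    simp [hb, hef, hx₁.form_eq_zero hΦ T.weight_f (by norm_num),
      hx₀.form_eq_zero hΦ T.weight_f (by norm_num), hy₁.form_eq_zero hΦ T.weight_f (by norm_num),
      T.weight_f.form_eq_zero hΦ T.weight_f (by norm_num)]
    ring
  rw [hΦb, hb] at c2
  obtain ⟨-, -, e0, e1', e2'⟩ := IsWeightVector.eq_zero_of_sum_eq_zero
    (IsWeightVector.zero h 2) (IsWeightVector.zero h 1)
    ((((IsWeightVector.self h).smul m).sub hV2).add (hx₀.smul 2)) (hy₁.smul 3)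
    (T.weight_f.smul (4 * β)) (by linear_combination (norm := module) c2)
  have hy₁0 : y₁ = 0 := by simpa using e1'
  have hβ : β • f = 0 := by
    rw [mul_smul] at e2'
    exact (smul_eq_zero.1 e2').resolve_left (by norm_num)
  rw [hy₁0, hβ, add_zero, add_zero] at hb
  have hΦbe : Φ b e = 0 := by
    simp [hb, hx₁.form_eq_zero hΦ T.weight_e (by norm_num),
      hx₀.form_eq_zero hΦ T.weight_e (by norm_num),
      T.weight_e.form_eq_zero hΦ T.weight_e (by norm_num)]
  have hbe : ⁅b, e⁆ = n • e := by
    simp [hb, T.lie_e_eq_zero hx₁, hn]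
  -- The coefficient of `t⁴` at `e` gives `n² = 0`.
  obtain ⟨-, -, c4⟩ := IsExtremal.curve hx e
  rw [hbe, hΦbe, lie_smul, hbe, zero_smul, smul_smul, smul_eq_zero] at c4
  have hn0 : n = 0 := by simpa using c4.resolve_right T.e_ne_zero
  -- `x₀` commutes with `h = ⁅e, f⁆`, so its eigenvalues `n` and `m` on `e` and `f` sum to zero.
  have hm0 : m • h = 0 := by
    have h1 : ⁅x₀, ⁅e, f⁆⁆ = m • h := by
      rw [leibniz_lie, hn, hm, hn0, zero_smul, zero_lie, zero_add, lie_smul, T.lie_e_f]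
    rw [← h1, T.lie_e_f, ← lie_skew, hx₀, zero_smul, neg_zero]
  have hm0' : m = 0 := (smul_eq_zero.1 hm0).resolve_right T.h_ne_zero
  have hx₀V : ⁅v, ⁅v, e⁆⁆ = (2 : ℂ) • x₀ := by
    rw [hm0] at e0
    linear_combination (norm := module) -e0
  -- The weight -1 part of the coefficient of `t³` at `f` is `⁅x₀, v⁆ = 0`.
  obtain ⟨-, c3, -⟩ := IsExtremal.curve hx f
  rw [hbf, hAf, hΦA, hΦb, hm0', zero_smul, zero_smul, add_zero, zero_add, hb, add_lie, add_lie,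
    lie_add, smul_lie, lie_smul] at c3
  have w1 : IsWeightVector h (-1) ⁅x₁, f⁆ := hx₁.lie T.weight_f (by norm_num)
  obtain ⟨-, -, -, e3, -⟩ := IsWeightVector.eq_zero_of_sum_eq_zero
    (IsWeightVector.zero h 2)
    ((((hA.lie (IsWeightVector.self h) (by norm_num : (1 : ℂ) + 0 = 1)).smul α).add
      ((T.weight_e.lie hv (by norm_num : (2 : ℂ) + -1 = 1)).smul α)).sub (hA.smul (-2 * α)))
    ((hA.lie w1 (by norm_num : (1 : ℂ) + -1 = 0)).add (hx₁.lie hv (by norm_num)))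
    (hx₀.lie hv (by norm_num : (0 : ℂ) + -1 = -1))
    (IsWeightVector.zero h (-2)) (by linear_combination (norm := module) c3)
  rw [hx₀V, lie_smul, ← lie_skew, e3, neg_zero, smul_zero]

end IsContactTriple

end Weights

end AdjointVariety

namespace AdjointVariety

/-! ### The cone over the adjoint variety as the set of extremal elements. -/

section Orbit

variable {𝔤 : Type*} [LieRing 𝔤] [LieAlgebra ℂ 𝔤]

theorem IsWeightVector.ad_pow {h w x : 𝔤} {i k : ℂ} (hw : IsWeightVector h k w)
    (hx : IsWeightVector h i x) (n : ℕ) :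
    IsWeightVector h (n * k + i) (((LieAlgebra.ad ℂ 𝔤 w) ^ n) x) := by
  induction n with
  | zero => simpa using hx
  | succ n ih =>
    rw [pow_succ', Module.End.mul_apply, LieAlgebra.ad_apply]
    exact hw.lie ih (by push_cast; ring)

theorem IsExtremal.map_of_mem_adjointGroup [FiniteDimensional ℂ 𝔤] {Φ : LinearMap.BilinForm ℂ 𝔤}
    (hG : ∀ g ∈ adjointGroup 𝔤, ∀ y z, Φ (g y) (g z) = Φ y z) {x : 𝔤} (hx : IsExtremal Φ x)
    {g : 𝔤 ≃ₗ[ℂ] 𝔤} (hg : g ∈ adjointGroup 𝔤) : IsExtremal Φ (g x) := by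
  intro y
  obtain ⟨y, rfl⟩ := g.surjective y
  rw [← lie_map_of_mem_adjointGroup hg, ← lie_map_of_mem_adjointGroup hg, hx, hG g hg, map_smul]

theorem IsExtremal.smul {Φ : LinearMap.BilinForm ℂ 𝔤} {x : 𝔤} (hx : IsExtremal Φ x) (c : ℂ) :
    IsExtremal Φ (c • x) := by
  intro y
  simp only [smul_lie, lie_smul, hx y, map_smul, LinearMap.smul_apply, smul_eq_mul]
  module

namespace IsContactTriple

variable {e h f : 𝔤}

/-- Five steps lower the weight by at least 5, while the weights span an interval of length 4. -/
theorem ad_pow_five_eq_zero (T : IsContactTriple e h f) {k : ℂ} (hk : k = -1 ∨ k = -2) {w : 𝔤}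
    (hw : IsWeightVector h k w) : LieAlgebra.ad ℂ 𝔤 w ^ 5 = 0 := by
  ext x
  obtain ⟨a, b, x₁, x₀, y₁, hx₁, hx₀, hy₁, rfl⟩ := T.exists_decomposition x
  have key : ∀ {i : ℂ} {y : 𝔤}, IsWeightVector h i y → (i = 2 ∨ i = 1 ∨ i = 0 ∨ i = -1 ∨ i = -2) →
      ((LieAlgebra.ad ℂ 𝔤 w) ^ 5) y = 0 := by
    intro i y hy hi
    refine T.eq_zero_of_weight (hw.ad_pow hy 5) ?_ ?_ ?_ ?_ ?_ <;>
    · rcases hk with rfl | rfl <;> rcases hi with rfl | rfl | rfl | rfl | rfl <;> norm_num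
  rw [map_add, map_add, map_add, map_add, key (T.weight_e.smul a) (by simp), key hx₁ (by simp),
    key hx₀ (by simp), key hy₁ (by simp), key (T.weight_f.smul b) (by simp)]
  simp

theorem exists_exp (T : IsContactTriple e h f) {k : ℂ} (hk : k = -1 ∨ k = -2) {w : 𝔤}
    (hw : IsWeightVector h k w) : ∃ g ∈ adjointGroup 𝔤, ∀ y, g y = y + ⁅w, y⁆ +
      (1 / 2 : ℂ) • ⁅w, ⁅w, y⁆⁆ + (1 / 6 : ℂ) • ⁅w, ⁅w, ⁅w, y⁆⁆⁆ +
        (1 / 24 : ℂ) • ⁅w, ⁅w, ⁅w, ⁅w, y⁆⁆⁆⁆ := by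
  obtain ⟨g, hg, hgy⟩ := exists_isExpAd_of_ad_pow_eq_zero (T.ad_pow_five_eq_zero hk hw)
  refine ⟨g, mem_adjointGroup_of_isExpAd hg, fun y => ?_⟩
  rw [hgy]
  simp [Finset.sum_range_succ, pow_succ', Nat.factorial]

/-- Only the `f`-component of `y` survives `(ad e)²`, and `⁅e, ⁅e, f⁆⁆ = -2 • e` dictates the
normalisation of `Φ`. -/
theorem isExtremal_e (T : IsContactTriple e h f) {Φ : LinearMap.BilinForm ℂ 𝔤}
    (hΦ : ∀ x y z, Φ ⁅x, y⁆ z = Φ x ⁅y, z⁆) (hef : Φ e f = -2) : IsExtremal Φ e := by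
  intro y
  obtain ⟨a, b, x₁, x₀, y₁, hx₁, hx₀, hy₁, rfl⟩ := T.exists_decomposition y
  obtain ⟨n, hn⟩ := T.exists_eq_smul_e (T.weight_e.lie hx₀ (by norm_num))
  have h1 : ⁅e, x₁⁆ = 0 := by rw [← lie_skew, T.lie_e_eq_zero hx₁, neg_zero]
  have h2 : ⁅e, ⁅e, y₁⁆⁆ = 0 := by
    rw [← lie_skew, T.lie_e_eq_zero (T.weight_e.lie hy₁ (by norm_num)), neg_zero]
  simp only [lie_add, lie_smul, h1, h2, hn, lie_self, lie_zero, smul_zero, T.lie_e_f, T.lie_e_h, map_add, map_smul, hef,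
    T.weight_e.form_eq_zero hΦ T.weight_e (by norm_num : (2 : ℂ) + 2 ≠ 0),
    T.weight_e.form_eq_zero hΦ hx₁ (by norm_num : (2 : ℂ) + 1 ≠ 0),
    T.weight_e.form_eq_zero hΦ hx₀ (by norm_num : (2 : ℂ) + 0 ≠ 0),
    T.weight_e.form_eq_zero hΦ hy₁ (by norm_num : (2 : ℂ) + -1 ≠ 0), smul_eq_mul]
  module

/-- An extremal element in the open cell is conjugate to a multiple of `e`. -/
theorem exists_map_eq_smul_of_apply_ne_zero [FiniteDimensional ℂ 𝔤] (T : IsContactTriple e h f)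
    {Φ : LinearMap.BilinForm ℂ 𝔤} (hΦ : ∀ x y z, Φ ⁅x, y⁆ z = Φ x ⁅y, z⁆) (hef : Φ e f = -2)
    (hG : ∀ g ∈ adjointGroup 𝔤, ∀ y z, Φ (g y) (g z) = Φ y z) {x : 𝔤} (hx : IsExtremal Φ x)
    (hxf : Φ x f ≠ 0) : ∃ g ∈ adjointGroup 𝔤, ∃ c : ℂ, g x = c • e := by
  obtain ⟨a, b, x₁, x₀, y₁, hx₁, hx₀, hy₁, hsum⟩ := T.exists_decomposition x
  have hform : ∀ {i : ℂ} {z : 𝔤}, IsWeightVector h i z → i ≠ 2 → Φ z f = 0 := fun hz hi =>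
    hz.form_eq_zero hΦ T.weight_f fun h0 => hi (by linear_combination h0)
  have ha : a ≠ 0 := by
    rintro rfl
    apply hxf
    simp [hsum, hform hx₁ (by norm_num), hform hx₀ (by norm_num), hform hy₁ (by norm_num),
      hform T.weight_f (by norm_num)]
  -- kill the component of weight `1`
  have hw : IsWeightVector h (-1) ((-a⁻¹) • ⁅x₁, f⁆) :=
    (hx₁.lie T.weight_f (by norm_num)).smul _
  set w := (-a⁻¹) • ⁅x₁, f⁆ with hwdef
  have hwe : a • ⁅w, e⁆ = -x₁ := by
    rw [hwdef, smul_lie, T.lie_lie_f_e hx₁, smul_smul]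
    simp [ha]
  obtain ⟨g₁, hg₁, hg₁x⟩ := T.exists_exp (Or.inl rfl) hw
  obtain ⟨z₀, z₁, z₂, hz₀, hz₁, hz₂, hg₁z⟩ : ∃ z₀ z₁ z₂ : 𝔤, IsWeightVector h 0 z₀ ∧
      IsWeightVector h (-1) z₁ ∧ IsWeightVector h (-2) z₂ ∧ g₁ x = a • e + z₀ + z₁ + z₂ := by
    have L : ∀ {i j : ℂ} {z : 𝔤}, IsWeightVector h i z → -1 + i = j →
      IsWeightVector h j ⁅w, z⁆ := fun hz hij => hw.lie hz hij
    have v2 := T.weight_e.smul a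
    have v2' := L v2 (by norm_num : _ = (1 : ℂ))
    have v2'' := L v2' (by norm_num : _ = (0 : ℂ))
    have v2''' := L v2'' (by norm_num : _ = (-1 : ℂ))
    have v1' := L hx₁ (by norm_num : _ = (0 : ℂ))
    have v1'' := L v1' (by norm_num : _ = (-1 : ℂ))
    have v0' := L hx₀ (by norm_num : _ = (-1 : ℂ))
    have v0'' := L v0' (by norm_num : _ = (-2 : ℂ))
    have u1' := L hy₁ (by norm_num : _ = (-2 : ℂ))
    have low : ∀ {i : ℂ} {z : 𝔤}, IsWeightVector h i z → i = -2 → ⁅w, z⁆ = 0 := fun hz hi =>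
      T.eq_zero_of_weight (L hz rfl) (by rw [hi]; norm_num) (by rw [hi]; norm_num)
        (by rw [hi]; norm_num) (by rw [hi]; norm_num) (by rw [hi]; norm_num)
    have l0 := low v0'' rfl
    have lu := low u1' rfl
    have lf := low T.weight_f rfl
    have v1''' := L v1'' (by norm_num : _ = (-2 : ℂ))
    have l1 := low v1''' rfl
    have l2 := L v2''' (by norm_num : _ = (-2 : ℂ))
    refine ⟨_, _, _, (hx₀.add v1').add (v2''.smul (1 / 2)),
      ((hy₁.add v0').add (v1''.smul (1 / 2))).add (v2'''.smul (1 / 6)),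
      ((((T.weight_f.smul b).add u1').add (v0''.smul (1 / 2))).add (v1'''.smul (1 / 6))).add
        (l2.smul (1 / 24)), ?_⟩
    rw [hg₁x, hsum]
    simp only [lie_add, lie_smul, lf, l0, l1, lu, lie_zero, smul_zero]
    linear_combination (norm := module) hwe
  -- kill the component along `h`
  obtain ⟨m, hm⟩ := T.exists_eq_smul_f (hz₀.lie T.weight_f (by norm_num))
  obtain ⟨n, rfl⟩ := T.exists_eq_smul_f hz₂
  obtain ⟨g₂, hg₂, hg₂x⟩ := T.exists_exp (Or.inr rfl) (T.weight_f.smul (-m / (2 * a)))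
  -- Conjugating by `exp(s ad f)` subtracts `(s * a) • h` from `z₀`; this `s` makes the new
  -- weight-zero part commute with `f`.
  set s := -m / (2 * a) with hs
  have hsa : 2 * (s * a) = -m := by rw [hs]; field_simp
  have hfe : ⁅f, e⁆ = -h := by rw [← lie_skew, T.lie_e_f]
  have hfh : ⁅f, h⁆ = (2 : ℂ) • f := by rw [← lie_skew, T.weight_f]; module
  have hz₀f : ⁅f, z₀⁆ = -(m • f) := by rw [← lie_skew, hm]
  have hz₁f : ⁅f, z₁⁆ = 0 := by rw [← lie_skew, T.lie_f_eq_zero hz₁, neg_zero]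
  obtain ⟨p, hp⟩ : ∃ p : ℂ, g₂ (g₁ x) = a • e + (z₀ - (s * a) • h) + z₁ + p • f := by
    refine ⟨n - s * m - s ^ 2 * a, ?_⟩
    rw [hg₂x, hg₁z]
    simp only [smul_lie, lie_add, lie_smul, hfe, hfh, hz₀f, hz₁f, lie_neg, lie_self, lie_zero,
      smul_zero, smul_neg, neg_zero, add_zero]
    module
  -- conclude by the extremality equation
  refine ⟨g₂ * g₁, mul_mem hg₂ hg₁, a, ?_⟩
  rw [LinearEquiv.mul_apply]
  have hx₂ := (hx.map_of_mem_adjointGroup hG hg₁).map_of_mem_adjointGroup hG hg₂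
  set y := g₂ (g₁ x) with hy
  have hyf : ⁅y, f⁆ = a • h := by
    have hf := T.weight_f
    simp only [IsWeightVector] at hf
    rw [hp]
    simp only [add_lie, sub_lie, smul_lie, T.lie_e_f, hm, T.lie_f_eq_zero hz₁, lie_self, hf]
    have hsaf : (2 * (s * a)) • f = (-m) • f := by rw [hsa]
    linear_combination (norm := module) hsaf
  have hΦy : Φ y f = -2 * a := by
    rw [hp]
    simp [hef, hform hz₀ (by norm_num), hform (IsWeightVector.self h) (by norm_num),
      hform hz₁ (by norm_num), hform T.weight_f (by norm_num)]
    ring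
  have h1 := hx₂ f
  rw [hyf, hΦy, lie_smul] at h1
  -- As `⁅y, f⁆ = a • h`, extremality at `f` becomes `a • ⁅y, h⁆ = (-2 * a) • y`.
  have h2 : IsWeightVector h 2 y := by
    have : a • (⁅h, y⁆ - (2 : ℂ) • y) = 0 := by
      rw [← lie_skew h y]
      linear_combination (norm := module) -h1
    exact sub_eq_zero.1 ((smul_eq_zero.1 this).resolve_left ha)
  obtain ⟨e2, -⟩ := IsWeightVector.eq_zero_of_sum_eq_zero ((T.weight_e.smul a).sub h2)
    (IsWeightVector.zero h 1) (hz₀.sub ((IsWeightVector.self h).smul (s * a))) hz₁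
    (T.weight_f.smul p) (by linear_combination (norm := module) -hp)
  exact (sub_eq_zero.1 e2).symm

/-- Every nonzero extremal element lies on the cone over the adjoint variety. -/
theorem mk_mem_adjointOrbit_of_isExtremal [FiniteDimensional ℂ 𝔤] [LieAlgebra.IsSimple ℂ 𝔤]
    (H : LieSubalgebra ℂ 𝔤) [H.IsCartanSubalgebra] (T : IsContactTriple e h f)
    {Φ : LinearMap.BilinForm ℂ 𝔤} (hΦ : ∀ x y z, Φ ⁅x, y⁆ z = Φ x ⁅y, z⁆) (hef : Φ e f = -2)
    (hG : ∀ g ∈ adjointGroup 𝔤, ∀ y z, Φ (g y) (g z) = Φ y z) {x : 𝔤} (hx : IsExtremal Φ x)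
    (hx0 : x ≠ 0) : Projectivization.mk ℂ x hx0 ∈ adjointOrbit e := by
  have hl : Φ.flip f ≠ 0 := fun h0 => by
    have : Φ e f = 0 := LinearMap.congr_fun h0 e
    rw [hef] at this
    norm_num at this
  obtain ⟨g, hg, hgx⟩ := exists_mem_adjointGroup_apply_ne_zero H hx0 hl
  obtain ⟨g', hg', c, hc⟩ := T.exists_map_eq_smul_of_apply_ne_zero hΦ hef hG
    (hx.map_of_mem_adjointGroup hG hg) hgx
  exact mk_mem_adjointOrbit (mul_mem hg' hg) hc hx0

theorem isExtremal_of_mk_mem_adjointOrbit [FiniteDimensional ℂ 𝔤] (T : IsContactTriple e h f)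
    {Φ : LinearMap.BilinForm ℂ 𝔤} (hΦ : ∀ x y z, Φ ⁅x, y⁆ z = Φ x ⁅y, z⁆) (hef : Φ e f = -2)
    (hG : ∀ g ∈ adjointGroup 𝔤, ∀ y z, Φ (g y) (g z) = Φ y z) {x : 𝔤} (hx0 : x ≠ 0)
    (hx : Projectivization.mk ℂ x hx0 ∈ adjointOrbit e) : IsExtremal Φ x := by
  obtain ⟨g, hg, hge, hxg⟩ := hx
  obtain ⟨c, rfl⟩ := (Projectivization.mk_eq_mk_iff' ℂ _ _ hx0 hge).1 hxg
  exact ((T.isExtremal_e hΦ hef).map_of_mem_adjointGroup hG hg).smul c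

end IsContactTriple

end Orbit

end AdjointVariety

namespace AdjointVariety

/-! ### From the highest root to the contact grading and its invariant form. -/

section Roots

/-- If `y` and `-2 y` are both sums of elements of a linearly independent family, then `y = 0`. -/
theorem eq_zero_of_mem_closure_of_neg_two_smul_mem {ι M : Type*} [AddCommGroup M] [Module ℂ M]
    {r : ι → M} {s : Set ι} (hs : LinearIndepOn ℂ r s) {y : M}
    (h1 : y ∈ AddSubmonoid.closure (r '' s)) (h2 : -(2 • y) ∈ AddSubmonoid.closure (r '' s)) :
    y = 0 := by
  -- `l` is the height: a natural number on the closure, zero only at zero.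
  obtain ⟨l, hl⟩ : ∃ l : M →ₗ[ℂ] ℂ, ∀ i ∈ s, l (r i) = 1 := by
    have hli : LinearIndepOn ℂ id (r '' s) := hs.id_image
    let b := Module.Basis.extend hli
    refine ⟨b.constr ℂ fun _ => (1 : ℂ), fun i hi => ?_⟩
    have hmem : r i ∈ hli.extend (Set.subset_univ _) :=
      hli.subset_extend _ (Set.mem_image_of_mem r hi)
    have : r i = b ⟨r i, hmem⟩ := by simp [b]
    rw [this, Module.Basis.constr_basis]
  have key : ∀ z ∈ AddSubmonoid.closure (r '' s), ∃ n : ℕ, l z = n ∧ (n = 0 → z = 0) := by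
    intro z hz
    induction hz using AddSubmonoid.closure_induction with
    | mem z hz =>
      obtain ⟨i, hi, rfl⟩ := hz
      exact ⟨1, by simp [hl i hi], by simp⟩
    | zero => exact ⟨0, by simp, fun _ => rfl⟩
    | add a b _ _ ha hb =>
      obtain ⟨n, hn, hn'⟩ := ha
      obtain ⟨m, hm, hm'⟩ := hb
      refine ⟨n + m, by simp [hn, hm], fun h0 => ?_⟩
      rw [hn' (by omega), hm' (by omega), add_zero]
  obtain ⟨n, hn, hn'⟩ := key _ h1
  obtain ⟨m, hm, -⟩ := key _ h2
  refine hn' ?_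
  rw [map_neg, map_nsmul, hn, nsmul_eq_mul] at hm
  have : (m : ℂ) + 2 * n = 0 := by rw [← hm]; push_cast; ring
  have : m + 2 * n = 0 := by exact_mod_cast this
  omega

variable {𝔤 : Type*} [LieRing 𝔤] [LieAlgebra ℂ 𝔤] [FiniteDimensional ℂ 𝔤] [LieAlgebra.IsSimple ℂ 𝔤]
  {H : LieSubalgebra ℂ 𝔤} [H.IsCartanSubalgebra]

open LieAlgebra.IsKilling

/-- Reflecting `α` in `ρ` shows that `α - (k - 1)ρ` is a sum of simple roots. Twice this, plus `k -
2` copies of `2ρ = ρ - (-ρ)`, equals `-2(ρ - α)`; since `ρ - α` is also such a sum, its height is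
zero. -/
theorem IsHighestRoot.eq_of_two_le {b : (rootSystem H).Base} {ρ : H.root} (hρ : IsHighestRoot b ρ)
    {α : H.root} {k : ℤ} (hk : (rootSystem H).pairing α ρ = k) (h2 : 2 ≤ k) : α = ρ := by
  obtain ⟨k, rfl⟩ : ∃ n : ℕ, k = n + 2 := ⟨(k - 2).toNat, by omega⟩
  set S := AddSubmonoid.closure ((rootSystem H).root '' b.support)
  have hneg : ∀ β : H.root, (rootSystem H).root ρ + (rootSystem H).root β ∈ S := fun β => by
    have := hρ ((rootSystem H).reflectionPerm β β)
    rwa [(rootSystem H).root_reflectionPerm, (rootSystem H).reflection_apply_self, sub_neg_eq_add] at this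
  have h1 : (rootSystem H).root ρ - (rootSystem H).root α ∈ S := hρ α
  have h3 := hneg ((rootSystem H).reflectionPerm ρ α)
  rw [(rootSystem H).root_reflectionPerm, (rootSystem H).reflection_apply_root, hk] at h3
  have h4 := S.add_mem (S.add_mem h3 h3) (S.nsmul_mem (hneg ρ) k)
  have h5 : -(2 • ((rootSystem H).root ρ - (rootSystem H).root α)) ∈ S := by
    convert h4 using 1
    push_cast
    module
  have := eq_zero_of_mem_closure_of_neg_two_smul_mem b.linearIndepOn_root h1 h5
  exact ((rootSystem H).root.injective (sub_eq_zero.1 this)).symm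

theorem IsHighestRoot.pairing_cases {b : (rootSystem H).Base} {ρ : H.root}
    (hρ : IsHighestRoot b ρ) (α : H.root) :
    α = ρ ∨ (rootSystem H).root α = -(rootSystem H).root ρ ∨ (rootSystem H).pairing α ρ = 1 ∨
      (rootSystem H).pairing α ρ = 0 ∨ (rootSystem H).pairing α ρ = -1 := by
  obtain ⟨k, hk⟩ := (rootSystem H).exists_value (S := ℤ) α ρ
  replace hk : (rootSystem H).pairing α ρ = k := by simpa using hk.symm
  by_cases h2 : 2 ≤ k
  · exact Or.inl (hρ.eq_of_two_le hk h2)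
  by_cases h2' : k ≤ -2
  · right; left
    have hα : (rootSystem H).pairing ((rootSystem H).reflectionPerm α α) ρ = ((-k : ℤ) : ℂ) := by
      rw [(rootSystem H).pairing_reflectionPerm_self_left, hk]
      push_cast
      rfl
    have := hρ.eq_of_two_le hα (by omega)
    rw [← this, (rootSystem H).root_reflectionPerm, (rootSystem H).reflection_apply_self, neg_neg]
  · rw [hk]
    right; right
    have : k = 1 ∨ k = 0 ∨ k = -1 := by omega
    rcases this with rfl | rfl | rfl <;> simp

theorem isWeightVector_of_mem_rootSpace {h : 𝔤} {α ρ : H.root}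
    (hh : h = (coroot (ρ : LieModule.Weight ℂ H 𝔤) : H)) {x : 𝔤}
    (hx : x ∈ LieAlgebra.rootSpace H (α : LieModule.Weight ℂ H 𝔤)) :
    IsWeightVector h ((rootSystem H).pairing α ρ) x := by
  rw [IsWeightVector, hh, rootSystem_pairing_apply]
  exact lie_eq_smul_of_mem_rootSpace hx _

/-- The contact grading attached to a highest root vector. -/
theorem IsHighestRoot.exists_isContactTriple {b : (rootSystem H).Base} {ρ : H.root}
    (hρ : IsHighestRoot b ρ) {e : 𝔤}
    (he : e ∈ LieAlgebra.rootSpace H (ρ : LieModule.Weight ℂ H 𝔤)) (he₀ : e ≠ 0) :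
    ∃ h f : 𝔤, IsContactTriple e h f ∧ h = (coroot (ρ : LieModule.Weight ℂ H 𝔤) : H) := by
  have hρ0 : (ρ : LieModule.Weight ℂ H 𝔤).IsNonZero := (Finset.mem_filter.1 ρ.2).2
  obtain ⟨h, e', f', ht, he', hf'⟩ := exists_isSl2Triple_of_weight_isNonZero hρ0
  have hh := ht.h_eq_coroot hρ0 he' hf'
  have hfin := finrank_rootSpace_eq_one _ hρ0
  have hline : ∀ y ∈ LieAlgebra.rootSpace H (ρ : LieModule.Weight ℂ H 𝔤), ∃ c : ℂ, c • e = y := by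
    intro y hy
    obtain ⟨c, hc⟩ := (finrank_eq_one_iff_of_nonzero' (⟨e, he⟩ : LieAlgebra.rootSpace H _)
      (by simpa [Subtype.ext_iff] using he₀)).1 hfin ⟨y, hy⟩
    exact ⟨c, congrArg Subtype.val hc⟩
  obtain ⟨c, rfl⟩ := hline e' he'
  have hf0 : f' ≠ 0 := ht.f_ne_zero
  have hlinef : ∀ y ∈ LieAlgebra.rootSpace H (-(ρ : LieModule.Weight ℂ H 𝔤) :
      LieModule.Weight ℂ H 𝔤), ∃ c : ℂ, c • f' = y := by
    intro y hy
    obtain ⟨c, hc⟩ := (finrank_eq_one_iff_of_nonzero' (⟨f', by simpa using hf'⟩ :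
      LieAlgebra.rootSpace H (-(ρ : LieModule.Weight ℂ H 𝔤) : LieModule.Weight ℂ H 𝔤))
      (by simpa [Subtype.ext_iff] using hf0)).1
      (finrank_rootSpace_eq_one _ (by simpa using hρ0)) ⟨y, hy⟩
    exact ⟨c, congrArg Subtype.val hc⟩
  have hc : c ≠ 0 := by
    rintro rfl
    exact ht.e_ne_zero (by simp)
  refine ⟨h, c • f', ⟨he₀, ?_, ?_, ?_, ?_⟩, hh⟩
  · rw [lie_smul, ← smul_lie, ht.lie_e_f]
  · have := isWeightVector_of_mem_rootSpace (α := ρ) hh he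
    rwa [RootPairing.pairing_same] at this
  · refine IsWeightVector.smul c ?_
    rw [IsWeightVector, ht.lie_h_f_nsmul, two_nsmul]
    module
  -- The root space decomposition, sorted by the value of each weight on the coroot of `ρ`; the
  -- Cartan subalgebra falls in eigenvalue 0.
  · have hD : (⊤ : Submodule ℂ 𝔤) ≤ LinearMap.range
        (LinearMap.toSpanSingleton ℂ 𝔤 e) ⊔ (Module.End.eigenspace (LieAlgebra.ad ℂ 𝔤 h) 1 ⊔
        (Module.End.eigenspace (LieAlgebra.ad ℂ 𝔤 h) 0 ⊔
        (Module.End.eigenspace (LieAlgebra.ad ℂ 𝔤 h) (-1) ⊔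
        LinearMap.range (LinearMap.toSpanSingleton ℂ 𝔤 (c • f'))))) := by
      have htop := congrArg LieSubmodule.toSubmodule
        (LieModule.iSup_genWeightSpace_eq_top' ℂ H 𝔤)
      rw [LieSubmodule.top_toSubmodule, LieSubmodule.iSup_toSubmodule] at htop
      rw [← htop, iSup_le_iff]
      intro α y hy
      by_cases hα : α.IsZero
      · have hy0 : y ∈ LieAlgebra.rootSpace H (0 : H → ℂ) := by
          rw [← show (α : H → ℂ) = 0 from hα]; exact hy
        have : y ∈ Module.End.eigenspace (LieAlgebra.ad ℂ 𝔤 h) 0 := by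
          rw [Module.End.mem_eigenspace_iff, LieAlgebra.ad_apply, hh]
          exact lie_eq_smul_of_mem_rootSpace hy0 _
        exact Submodule.mem_sup_right (Submodule.mem_sup_right (Submodule.mem_sup_left this))
      · let α' : H.root := ⟨α, by simpa using hα⟩
        have hw : IsWeightVector h ((rootSystem H).pairing α' ρ) y :=
          isWeightVector_of_mem_rootSpace hh hy
        have hw' := Module.End.mem_eigenspace_iff.2 (show LieAlgebra.ad ℂ 𝔤 h y = _ from hw)
        rcases hρ.pairing_cases α' with hα' | hα' | hα' | hα' | hα'
        · obtain ⟨d, hd⟩ := hline y (by rw [← hα']; exact hy)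
          exact Submodule.mem_sup_left ⟨d, by simpa using hd⟩
        · have hneg : α = -(ρ : LieModule.Weight ℂ H 𝔤) := by
            ext z
            have := LinearMap.congr_fun hα' z
            simpa using this
          obtain ⟨d, hd⟩ := hlinef y (by rw [← hneg]; exact hy)
          refine Submodule.mem_sup_right (Submodule.mem_sup_right (Submodule.mem_sup_right
            (Submodule.mem_sup_right ⟨d * c⁻¹, ?_⟩)))
          rw [LinearMap.toSpanSingleton_apply, smul_smul, mul_assoc, inv_mul_cancel₀ hc, mul_one,
            hd]
        · rw [hα'] at hw'
          exact Submodule.mem_sup_right (Submodule.mem_sup_left hw')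
        · rw [hα'] at hw'
          exact Submodule.mem_sup_right (Submodule.mem_sup_right (Submodule.mem_sup_left hw'))
        · rw [hα'] at hw'
          exact Submodule.mem_sup_right (Submodule.mem_sup_right (Submodule.mem_sup_right
            (Submodule.mem_sup_left hw')))
    intro x
    obtain ⟨_, ⟨s, rfl⟩, u₁, hu₁, rfl⟩ := Submodule.mem_sup.1 (hD (Submodule.mem_top (x := x)))
    obtain ⟨x₁, hx₁, u₀, hu₀, rfl⟩ := Submodule.mem_sup.1 hu₁
    obtain ⟨x₀, hx₀, w₁, hw₁, rfl⟩ := Submodule.mem_sup.1 hu₀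
    obtain ⟨y₁, hy₁, _, ⟨t, rfl⟩, rfl⟩ := Submodule.mem_sup.1 hw₁
    refine ⟨s, t, x₁, x₀, y₁, Module.End.mem_eigenspace_iff.1 hx₁,
      Module.End.mem_eigenspace_iff.1 hx₀, Module.End.mem_eigenspace_iff.1 hy₁, ?_⟩
    simp only [LinearMap.toSpanSingleton_apply]
    abel

theorem isWeightVector_of_mem_contactHyperplane {h : 𝔤} {ρ : H.root}
    (hh : h = (coroot (ρ : LieModule.Weight ℂ H 𝔤) : H)) {v : 𝔤}
    (hv : v ∈ contactHyperplane ρ) : IsWeightVector h (-1) v := by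
  suffices contactHyperplane ρ ≤ Module.End.eigenspace (LieAlgebra.ad ℂ 𝔤 h) (-1) from
    Module.End.mem_eigenspace_iff.1 (this hv)
  refine iSup₂_le fun α hα y hy => Module.End.mem_eigenspace_iff.2 ?_
  rw [← hα]
  exact isWeightVector_of_mem_rootSpace hh hy

/-- The multiple of the Killing form adapted to a contact triple. -/
theorem IsContactTriple.exists_form {e h f : 𝔤} (T : IsContactTriple e h f) :
    ∃ Φ : LinearMap.BilinForm ℂ 𝔤, (∀ x y z, Φ ⁅x, y⁆ z = Φ x ⁅y, z⁆) ∧ Φ e f = -2 ∧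
      ∀ g ∈ adjointGroup 𝔤, ∀ y z, Φ (g y) (g z) = Φ y z := by
  have hinv : ∀ x y z, killingForm ℂ 𝔤 ⁅x, y⁆ z = killingForm ℂ 𝔤 x ⁅y, z⁆ :=
    LieModule.traceForm_apply_lie_apply ℂ 𝔤 𝔤
  -- By weights, `e` pairs to zero with every component except the `f`-component, so nondegeneracy
  -- forces this value to be nonzero.
  have h0 : killingForm ℂ 𝔤 e f ≠ 0 := by
    intro h0
    apply T.e_ne_zero
    apply (LieAlgebra.IsKilling.killingForm_nondegenerate ℂ 𝔤).1
    intro y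
    obtain ⟨a, b, x₁, x₀, y₁, hx₁, hx₀, hy₁, rfl⟩ := T.exists_decomposition y
    simp [h0, T.weight_e.form_eq_zero hinv T.weight_e (by norm_num),
      T.weight_e.form_eq_zero hinv hx₁ (by norm_num),
      T.weight_e.form_eq_zero hinv hx₀ (by norm_num),
      T.weight_e.form_eq_zero hinv hy₁ (by norm_num)]
  refine ⟨(-2 / killingForm ℂ 𝔤 e f) • killingForm ℂ 𝔤, fun x y z => ?_, ?_, fun g hg y z => ?_⟩
  · rw [LinearMap.smul_apply, LinearMap.smul_apply, LinearMap.smul_apply, LinearMap.smul_apply,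
      hinv]
  · rw [LinearMap.smul_apply, LinearMap.smul_apply, smul_eq_mul, div_mul_cancel₀ _ h0]
  · rw [LinearMap.smul_apply, LinearMap.smul_apply, LinearMap.smul_apply, LinearMap.smul_apply,
      killingForm_map_of_mem_adjointGroup hg]

end Roots

end AdjointVariety

namespace AdjointVariety

/-! ### Lines and conics built from `e`, `[v, e]` and `[v, [v, e]]`. -/

section Main

variable {𝔤 : Type*} [LieRing 𝔤] [LieAlgebra ℂ 𝔤]

/-- Moves the tangency condition up to the affine cone, where it can be tested on curves and
equations. -/
theorem projTangentSpace_eq_of_forall {C : Set (ℙ ℂ 𝔤)} {e v : 𝔤}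
    (h1 : ⁅v, e⁆ ∈ coneTangentSpace C e)
    (h2 : ∀ w ∈ coneTangentSpace C e, ∃ s r : ℂ, w = s • e + r • ⁅v, e⁆) :
    projTangentSpace C e = (ℂ ∙ v).map (orbitDifferential e) := by
  rw [Submodule.map_span, Set.image_singleton]
  apply le_antisymm
  · rintro _ ⟨w, hw, rfl⟩
    obtain ⟨s, r, rfl⟩ := h2 w hw
    refine Submodule.mem_span_singleton.2 ⟨r, ?_⟩
    have : (ℂ ∙ e).mkQ e = 0 := by simp
    rw [map_add, map_smul, map_smul, this, smul_zero, zero_add]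
    rfl
  · rw [Submodule.span_singleton_le_iff_mem]
    exact ⟨_, h1, rfl⟩

theorem mkQ_lie_mem_projTangentSpace {C : Set (ℙ ℂ 𝔤)} {e v : 𝔤} {he : e ≠ 0}
    (h : IsTangentAt C e he v) : (ℂ ∙ e).mkQ ⁅v, e⁆ ∈ projTangentSpace C e := by
  rw [h.2]
  exact ⟨v, Submodule.mem_span_singleton_self v, rfl⟩

/-- The span of three vectors `e`, `a`, `b` contains the conic `s² e + s r a + r² b`. -/
theorem exists_isSmoothConic_isTangentAt [FiniteDimensional ℂ 𝔤] {Z : Set (ℙ ℂ 𝔤)} {e v b : 𝔤}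
    (he : e ≠ 0) (hli : LinearIndependent ℂ ![e, ⁅v, e⁆, b])
    (hZ : ∀ (s r u : ℂ) (hx : s • e + r • ⁅v, e⁆ + u • b ≠ 0), r ^ 2 = s * u →
      Projectivization.mk ℂ _ hx ∈ Z) :
    ∃ C : Set (ℙ ℂ 𝔤), IsSmoothConic C ∧ C ⊆ Z ∧ IsTangentAt C e he v := by
  obtain ⟨l, hl⟩ := exists_dual_family hli
  set U := Submodule.span ℂ (Set.range ![e, ⁅v, e⁆, b]) with hU
  have hmem : ∀ s r u : ℂ, s • e + r • ⁅v, e⁆ + u • b ∈ U := fun s r u => by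
    rw [hU, Submodule.mem_span_range_iff_exists_fun]
    exact ⟨![s, r, u], by simp [Fin.sum_univ_three]⟩
  have hl' : ∀ s r u : ℂ, l 0 (s • e + r • ⁅v, e⁆ + u • b) = s ∧
      l 1 (s • e + r • ⁅v, e⁆ + u • b) = r ∧ l 2 (s • e + r • ⁅v, e⁆ + u • b) = u := by
    intro s r u
    have := (hl _ (hmem s r u) ![s, r, u]).1 (by simp [Fin.sum_univ_three])
    exact ⟨this 0, this 1, this 2⟩
  have hrep : ∀ x ∈ U, x = l 0 x • e + l 1 x • ⁅v, e⁆ + l 2 x • b := by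
    intro x hx
    have := (hl x hx fun i => l i x).2 fun i => rfl
    simpa [Fin.sum_univ_three] using this
  -- In the coordinates `s, r, u` the quadratic form is `r² - s u`. This `β` is not symmetric, but
  -- only its symmetrisation matters.
  let β : LinearMap.BilinForm ℂ 𝔤 := (LinearMap.mul ℂ ℂ).compl₁₂ (l 1) (l 1) -
    (LinearMap.mul ℂ ℂ).compl₁₂ (l 0) (l 2)
  have hβ : ∀ x y, β x y = l 1 x * l 1 y - l 0 x * l 2 y := fun x y => by simp [β]
  let Q : QuadraticForm ℂ U := (LinearMap.BilinMap.toQuadraticMap β).comp U.subtype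
  have hQ : ∀ x : U, Q x = β x x := fun x => rfl
  let C : Set (ℙ ℂ 𝔤) := {p | ∃ (x : U) (hx : (x : 𝔤) ≠ 0),
    p = Projectivization.mk ℂ (x : 𝔤) hx ∧ Q x = 0}
  have hC : ∀ (x : 𝔤) (hx : x ≠ 0), Projectivization.mk ℂ x hx ∈ C ↔
      ∃ y : U, (y : 𝔤) = x ∧ Q y = 0 := fun x hx => mk_mem_zeroLocus_iff Q hx
  have hcurve : ∀ t : ℂ, Q ⟨(1 : ℂ) • e + t • ⁅v, e⁆ + t ^ 2 • b, hmem _ _ _⟩ = 0 := fun t => by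
    rw [hQ, hβ, (hl' 1 t (t ^ 2)).1, (hl' 1 t (t ^ 2)).2.1, (hl' 1 t (t ^ 2)).2.2]
    ring
  have hne : ∀ t : ℂ, e + t • ⁅v, e⁆ + t ^ 2 • b ≠ 0 := fun t h0 => by
    have := (hl' 1 t (t ^ 2)).1
    rw [one_smul, h0, map_zero] at this
    exact zero_ne_one this
  have hmemC : ∀ t : ℂ, Projectivization.mk ℂ _ (hne t) ∈ C := fun t =>
    (hC _ _).2 ⟨_, by simp, hcurve t⟩
  refine ⟨C, ⟨U, ?_, Q, ?_, rfl⟩, ?_, ?_, ?_⟩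
  · rw [hU, finrank_span_eq_card hli, Fintype.card_fin]
  · let _ : Invertible (2 : ℂ) := invertibleOfNonzero two_ne_zero
    rw [QuadraticMap.nondegenerate_iff_radical_eq_bot, eq_bot_iff]
    intro x hx
    have hpol : ∀ y : U, β x y + β y x = 0 := by
      intro y
      rw [QuadraticMap.mem_radical_iff'] at hx
      have h1 := hx.2 y
      have h2 := hx.1
      simp only [hQ, Submodule.coe_add, map_add, LinearMap.add_apply] at h1 h2
      linear_combination h1 - h2
    have k0 := hpol ⟨_, hmem 0 0 1⟩
    have k1 := hpol ⟨_, hmem 0 1 0⟩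
    have k2 := hpol ⟨_, hmem 1 0 0⟩
    simp only [hβ, hl'] at k0 k1 k2
    have e0 : l 0 (x : 𝔤) = 0 := by linear_combination -k0
    have e1 : l 1 (x : 𝔤) = 0 := by linear_combination k1 / 2
    have e2 : l 2 (x : 𝔤) = 0 := by linear_combination -k2
    rw [Submodule.mem_bot, Subtype.ext_iff, hrep x x.2, e0, e1, e2]
    simp
  · rintro _ ⟨x, hx, rfl, hQx⟩
    have hx' := hx
    rw [hrep x x.2] at hx'
    have := hZ _ _ _ hx' (by rw [hQ, hβ] at hQx; linear_combination hQx)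
    simp only [← hrep x x.2] at this
    exact this
  · simpa using hmemC 0
  · refine projTangentSpace_eq_of_forall (mem_coneTangentSpace_of_curve hne hmemC) fun w hw => ?_
    have hwU := coneTangentSpace_le (U := U) (fun x hx hxC => by
      obtain ⟨y, rfl, -⟩ := (hC x hx).1 hxC
      exact y.2) e hw
    have hb := bilinear_eq_zero_of_mem_coneTangentSpace β (fun x hx hxC => by
      obtain ⟨y, rfl, hy⟩ := (hC x hx).1 hxC
      exact hy) hw
    have hl1 := hl' 1 0 0
    simp only [one_smul, zero_smul, add_zero] at hl1
    -- The differential of `r² - s u` at `e = (1, 0, 0)` is `-u`, so tangent vectors have no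
    -- `b`-component.
    rw [hβ, hβ, hl1.1, hl1.2.1, hl1.2.2] at hb
    have h2 : l 2 w = 0 := by linear_combination -hb
    refine ⟨l 0 w, l 1 w, ?_⟩
    conv_lhs => rw [hrep w hwU, h2, zero_smul, add_zero]

theorem exists_isLine_isTangentAt {Z : Set (ℙ ℂ 𝔤)} {e v : 𝔤}
    (he : e ≠ 0) (hli : LinearIndependent ℂ ![e, ⁅v, e⁆])
    (hZ : ∀ (s r : ℂ) (hx : s • e + r • ⁅v, e⁆ ≠ 0), Projectivization.mk ℂ _ hx ∈ Z) :
    ∃ C : Set (ℙ ℂ 𝔤), IsLine C ∧ C ⊆ Z ∧ IsTangentAt C e he v := by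
  set U := Submodule.span ℂ (Set.range ![e, ⁅v, e⁆]) with hU
  have hmem : ∀ x, x ∈ U ↔ ∃ s r : ℂ, s • e + r • ⁅v, e⁆ = x := fun x => by
    rw [hU, Matrix.range_cons, Matrix.range_cons, Matrix.range_empty, Set.union_empty,
      Set.singleton_union, Submodule.mem_span_pair]
  -- The zero quadratic term puts the line in the form required by `mem_coneTangentSpace_of_curve`.
  have hne : ∀ t : ℂ, e + t • ⁅v, e⁆ + t ^ 2 • (0 : 𝔤) ≠ 0 := fun t h0 => by
    have := (LinearIndependent.pair_iff.1 hli 1 t (by simpa using h0)).1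
    exact one_ne_zero this
  have hmemC : ∀ t : ℂ, Projectivization.mk ℂ _ (hne t) ∈ {p : ℙ ℂ 𝔤 | p.submodule ≤ U} :=
    fun t => (mk_mem_line_iff _).2 ((hmem _).2 ⟨1, t, by simp⟩)
  refine ⟨{p | p.submodule ≤ U}, ⟨U, ?_, rfl⟩, ?_, ?_, ?_⟩
  · rw [hU, finrank_span_eq_card hli, Fintype.card_fin]
  · intro p
    induction p using Projectivization.ind with
    | h x hx =>
      intro hp
      obtain ⟨s, r, rfl⟩ := (hmem x).1 ((mk_mem_line_iff hx).1 hp)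
      exact hZ s r hx
  · simpa using hmemC 0
  · refine projTangentSpace_eq_of_forall (mem_coneTangentSpace_of_curve hne hmemC) fun w hw => ?_
    obtain ⟨s, r, h⟩ := (hmem w).1
      (coneTangentSpace_le (fun x hx => (mk_mem_line_iff hx).1) e hw)
    exact ⟨s, r, h.symm⟩

namespace IsContactTriple

variable {e h f : 𝔤}

theorem lie_e_ne_zero (T : IsContactTriple e h f) {v : 𝔤} (hv : IsWeightVector h (-1) v)
    (hv₀ : v ≠ 0) : ⁅v, e⁆ ≠ 0 := fun h0 => hv₀ (by rw [← T.lie_lie_e_f hv, h0, zero_lie])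

theorem linearIndependent_pair (T : IsContactTriple e h f) {x : 𝔤} (hx : IsWeightVector h 1 x)
    (hx₀ : x ≠ 0) : LinearIndependent ℂ ![e, x] := by
  rw [LinearIndependent.pair_iff]
  intro s r hsr
  obtain ⟨e2, e1, -⟩ := IsWeightVector.eq_zero_of_sum_eq_zero (T.weight_e.smul s) (hx.smul r)
    (IsWeightVector.zero h 0) (IsWeightVector.zero h (-1)) (IsWeightVector.zero h (-2))
    (by simpa using hsr)
  exact ⟨(smul_eq_zero.1 e2).resolve_right T.e_ne_zero, (smul_eq_zero.1 e1).resolve_right hx₀⟩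

theorem linearIndependent_triple (T : IsContactTriple e h f) {x y : 𝔤}
    (hx : IsWeightVector h 1 x) (hx₀ : x ≠ 0) (hy : IsWeightVector h 0 y) (hy₀ : y ≠ 0) :
    LinearIndependent ℂ ![e, x, y] := by
  rw [Fintype.linearIndependent_iff]
  intro c hc
  simp only [Fin.sum_univ_three, Matrix.cons_val_zero, Matrix.cons_val_one, Matrix.cons_val] at hc
  obtain ⟨e2, e1, e0, -⟩ := IsWeightVector.eq_zero_of_sum_eq_zero (T.weight_e.smul (c 0))
    (hx.smul (c 1)) (hy.smul (c 2)) (IsWeightVector.zero h (-1)) (IsWeightVector.zero h (-2))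
    (by simpa using hc)
  intro i
  fin_cases i
  · exact (smul_eq_zero.1 e2).resolve_right T.e_ne_zero
  · exact (smul_eq_zero.1 e1).resolve_right hx₀
  · exact (smul_eq_zero.1 e0).resolve_right hy₀

/-- If `[v, [v, [v, e]]] = 0`, then the curve `exp (t v) e` is quadratic, and consists of extremal
elements. -/
theorem isExtremal_curve [FiniteDimensional ℂ 𝔤] (T : IsContactTriple e h f)
    {Φ : LinearMap.BilinForm ℂ 𝔤} (hΦ : ∀ x y z, Φ ⁅x, y⁆ z = Φ x ⁅y, z⁆) (hef : Φ e f = -2)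
    (hG : ∀ g ∈ adjointGroup 𝔤, ∀ y z, Φ (g y) (g z) = Φ y z) {v : 𝔤}
    (hv : IsWeightVector h (-1) v) (hv3 : ⁅v, ⁅v, ⁅v, e⁆⁆⁆ = 0) (t : ℂ) :
    IsExtremal Φ (e + t • ⁅v, e⁆ + t ^ 2 • ((1 / 2 : ℂ) • ⁅v, ⁅v, e⁆⁆)) := by
  obtain ⟨g, hg, hge⟩ := T.exists_exp (Or.inl rfl) (hv.smul t)
  have := (T.isExtremal_e hΦ hef).map_of_mem_adjointGroup hG hg
  rw [hge] at this
  simp only [smul_lie, lie_smul, hv3, lie_zero, smul_zero, add_zero] at this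
  convert this using 2
  module

end IsContactTriple

end Main

end AdjointVariety

theorem mainTheorem9 {𝔤 : Type*} [LieRing 𝔤] [LieAlgebra ℂ 𝔤] [FiniteDimensional ℂ 𝔤]
    [LieAlgebra.IsSimple ℂ 𝔤] (H : LieSubalgebra ℂ 𝔤) [H.IsCartanSubalgebra]
    (b : (LieAlgebra.IsKilling.rootSystem H).Base) (ρ : H.root)
    (hρ : AdjointVariety.IsHighestRoot b ρ)
    (E : 𝔤) (hE : E ∈ LieAlgebra.rootSpace H (ρ : LieModule.Weight ℂ H 𝔤)) (hE₀ : E ≠ 0)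
    (v : 𝔤) (hv : v ∈ AdjointVariety.contactHyperplane ρ) (hv₀ : v ≠ 0) :
    (∃ C : Set (ℙ ℂ 𝔤),
        (AdjointVariety.IsLine C ∨ AdjointVariety.IsSmoothConic C) ∧
        C ⊆ AdjointVariety.adjointOrbit E ∧
        AdjointVariety.IsTangentAt C E hE₀ v) ↔
      ⁅v, ⁅v, ⁅v, E⁆⁆⁆ = 0 := by
  open AdjointVariety in
  obtain ⟨h, f, T, hh⟩ := hρ.exists_isContactTriple hE hE₀
  have hvw : IsWeightVector h (-1) v := isWeightVector_of_mem_contactHyperplane hh hv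
  obtain ⟨Φ, hΦ, hef, hG⟩ := T.exists_form
  have hA : IsWeightVector h 1 ⁅v, E⁆ := hvw.lie T.weight_e (by norm_num)
  constructor
  · rintro ⟨C, hC, hCZ, hCv⟩
    have ha := mkQ_lie_mem_projTangentSpace hCv
    obtain ⟨w, hw⟩ : ∃ w : 𝔤, ∀ (t : ℂ) (ht : E + t • ⁅v, E⁆ + t ^ 2 • w ≠ 0),
        Projectivization.mk ℂ _ ht ∈ C := by
      rcases hC with hC | hC
      · refine ⟨0, ?_⟩
        simp only [smul_zero, add_zero]
        exact fun t ht => hC.add_smul_mem hE₀ hCv.1 ha t ht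
      · exact hC.exists_add_smul_mem hE₀ hCv.1 ha
    refine T.lie_lie_lie_eq_zero hΦ hef hvw (b := w) fun t => ?_
    -- The curve may pass through zero, which is trivially extremal.
    by_cases ht : E + t • ⁅v, E⁆ + t ^ 2 • w = 0
    · rw [ht]
      intro y
      simp
    · exact T.isExtremal_of_mk_mem_adjointOrbit hΦ hef hG ht (hCZ (hw t ht))
  · intro hv3
    have hcurve := T.isExtremal_curve hΦ hef hG hvw hv3
    set B := (1 / 2 : ℂ) • ⁅v, ⁅v, E⁆⁆ with hB
    have hBw : IsWeightVector h 0 B := (hvw.lie hA (by norm_num)).smul _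
    have hA₀ := T.lie_e_ne_zero hvw hv₀
    -- Away from `s = 0`, a point of the conic is `s` times the point of the curve with parameter `r
    -- / s`.
    have hcone : ∀ s r u : ℂ, s ≠ 0 → r ^ 2 = s * u →
        IsExtremal Φ (s • E + r • ⁅v, E⁆ + u • B) := by
      intro s r u hs hsu
      have := (hcurve (r / s)).smul s
      have hu : s * (r / s) ^ 2 = u := by field_simp; exact hsu
      rwa [smul_add, smul_add, smul_smul, smul_smul, mul_div_cancel₀ _ hs, hu] at this
    by_cases hB0 : B = 0
    · obtain ⟨C, hC, hCZ, hCv⟩ := exists_isLine_isTangentAt (Z := adjointOrbit E) hE₀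
        (T.linearIndependent_pair hA hA₀) fun s r hx => by
          refine T.mk_mem_adjointOrbit_of_isExtremal H hΦ hef hG ?_ hx
          by_cases hs : s = 0
          -- The point at infinity of the line: with `B = 0`, the coefficient of `t²` says that `⁅v,
          -- E⁆` is extremal.
          · rw [hs, zero_smul, zero_add]
            refine IsExtremal.smul (fun y => ?_) r
            simpa [hB0] using (IsExtremal.curve hcurve y).1
          · simpa [hB0] using hcone s r (r ^ 2 / s) hs (by field_simp)
      exact ⟨C, Or.inl hC, hCZ, hCv⟩
    · obtain ⟨C, hC, hCZ, hCv⟩ := exists_isSmoothConic_isTangentAt (Z := adjointOrbit E) hE₀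
        (T.linearIndependent_triple hA hA₀ hBw hB0) fun s r u hx hsu => by
          refine T.mk_mem_adjointOrbit_of_isExtremal H hΦ hef hG ?_ hx
          by_cases hs : s = 0
          -- The point at infinity of the conic is `[B]`, extremal by the coefficient of `t⁴`.
          · have hr : r = 0 := by simpa [hs] using hsu
            rw [hs, hr, zero_smul, zero_smul, zero_add, zero_add]
            exact IsExtremal.smul (fun y => (IsExtremal.curve hcurve y).2.2) u
          · exact hcone s r u hs hsu
      exact ⟨C, Or.inr hC, hCZ, hCv⟩
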